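/- **Setting.** A labeled graph $G$ on a vertex set $V$ is the complete graph on $V$ with every edge labeled $+$ or $-$. A clustering $\mathcal C$ is a partition of $V$; its cost $\mathrm{cost}_G(\mathcal C)$ is the number of $(+)$-edges between different clusters plus the number of $(-)$-edges inside clusters. An $\alpha$-approximation to correlation clustering on $G$ is a clustering $\mathcal C$ with $\mathrm{cost}_G(\mathcal C)\le \alpha\cdot \mathrm{cost}_G(\mathcal C')$ for every clustering $\mathcal C'$. A dynamic stream of $G$ is a finite sequence of tuples $(u_i,v_i,\Delta_i)$, where $u_i\neq v_i$ are vertices and $\Delta_i$ is one of: insertion of $+$, removal of $+$, insertion of $-$, removal of $-$. Initially no pair has a label; a label may be inserted on a pair only if the pair currently has no label; a label may be removed from a pair only if the pair currently has that label; at the end of the stream every edge of $G$ has its label in $G$. The length of the stream is arbitrary. A randomized single-pass streaming algorithm is a (uniform) program for a random access machine that can toss fair coins (each toss can be read once). It knows $n=|V|$ at the start, receives the stream elements one at a time, once and in the given order, and outputs a clustering after the end of the stream. Its space is the maximum, over all times from the start up to and including the final computation, of the number of bits of memory in use (the lengths of the nonzero memory entries and of their indices). **Proposition.** There are constants $\alpha$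 and $k$ such that for every $c\in\mathbb N$ there are a randomized single-pass streaming algorithm $A$ and a constant $K$ with the following property. For every $n\ge 2$, every labeled graph $G$ on $V=\{0,\dots,n-1\}$ and every dynamic stream of $G$, 1. for every outcome of the coin tosses, $A$ halts, outputs a clustering and uses at most $K\, n\,(\log n)^k$ bits of space, that is, $\tilde O(n)$ space; 2. with probability at least $1-n^{-c}$ over the coin tosses of $A$, the output of $A$ is an $\alpha$-approximation to correlation clustering on $G$. -/

import Mathlib

open MeasureTheory

/-! Labeled graphs, clusterings and the correlation clustering objective. -/

/-- The two edge labels. -/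
inductive Label where
  | plus
  | minus

/-- A labeled graph on `V`: the complete graph on `V`, every edge of which carries a label. -/
abbrev LabeledGraph (V : Type*) : Type _ := (⊤ : SimpleGraph V).edgeSet → Label

/-- Both endpoints of `e` lie in the same cluster. A clustering of `V` is a partition of `V`,
given as the equivalence relation "lie in the same cluster". -/
def Together {V : Type*} (C : Setoid V) (e : Sym2 V) : Prop := ∀ u ∈ e, ∀ v ∈ e, C u v

open Classical in
/-- The cost of one edge: `1` for a `(+)`-edge between two clusters and for a `(-)`-edge inside
a cluster, and `0` otherwise. -/
noncomputable def edgeCost {V : Type*} (G : LabeledGraph V) (C : Setoid V)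
    (e : (⊤ : SimpleGraph V).edgeSet) : ℕ :=
  match G e with
  | Label.plus => if Together C e then 0 else 1
  | Label.minus => if Together C e then 1 else 0

open Classical in
/-- The total cost of a clustering: the sum of the costs of all edges. -/
noncomputable def clusterCost {V : Type*} [Fintype V] (G : LabeledGraph V) (C : Setoid V) : ℕ :=
  ∑ e : (⊤ : SimpleGraph V).edgeSet, edgeCost G C e

/-- `C` is an `α`-approximation to correlation clustering on `G`. -/
def IsApproxClustering {V : Type*} [Fintype V] (α : ℝ) (G : LabeledGraph V) (C : Setoid V) :
    Prop :=
  ∀ C' : Setoid V, (clusterCost G C : ℝ) ≤ α * (clusterCost G C' : ℝ)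

/-! Dynamic streams of labeled graphs. -/

/-- The kinds of update: insertion of a label, removal of a label. -/
inductive Change where
  | insert (l : Label)
  | remove (l : Label)

/-- A stream element `(u, v, Δ)`. -/
structure StreamItem (V : Type*) where
  u : V
  v : V
  change : Change

namespace StreamItem

variable {V : Type*}

/-- The item may occur when the current labels are `H` (`none`: no label at present): `u ≠ v`,
a label is inserted only where there is none, and only a label that is there is removed. -/
def Allowed (H : Sym2 V → Option Label) (x : StreamItem V) : Prop :=
  x.u ≠ x.v ∧
    match x.change with
    | Change.insert _ => H s(x.u, x.v) = none
    | Change.remove l => H s(x.u, x.v) = some l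

/-- The labels after the item has been processed. -/
def apply [DecidableEq V] (H : Sym2 V → Option Label) (x : StreamItem V) :
    Sym2 V → Option Label :=
  Function.update H s(x.u, x.v)
    (match x.change with
      | Change.insert l => some l
      | Change.remove _ => none)

end StreamItem

/-- `σ` is a legal sequence of updates leading from the labels `H` to the labeled graph `G`, on
which every edge has a label. -/
def LeadsTo {V : Type*} [DecidableEq V] (G : LabeledGraph V) :
    (Sym2 V → Option Label) → List (StreamItem V) → Prop
  | H, [] => ∀ e : (⊤ : SimpleGraph V).edgeSet, H e = some (G e)
  | H, x :: σ => x.Allowed H ∧ LeadsTo G (x.apply H) σ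

/-- `σ` is a dynamic stream of the labeled graph `G`; at the start no pair has a label. -/
def IsDynamicStream {V : Type*} [DecidableEq V] (σ : List (StreamItem V)) (G : LabeledGraph V) :
    Prop :=
  LeadsTo G (fun _ => none) σ

/-! Randomized random access machines with logarithmic space cost. -/

/-- The memory consists of arrays `0, 1, 2, …` of natural numbers; `m (k, i)` is entry `i` of
array `k`. All but finitely many entries are zero. -/
abbrev Mem : Type := ℕ × ℕ →₀ ℕ

/-- The number of bits in use: every nonzero entry is charged the binary length of its index and
of its value. (A program mentions only finitely many array names, so these are not charged.) -/
def Mem.bits (m : Mem) : ℕ := m.sum fun a x => Nat.size a.2 + Nat.size x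

/-- Write `x` to entry `i` of array `k`. -/
noncomputable def Mem.write (m : Mem) (k i x : ℕ) : Mem := Finsupp.update m (k, i) x

/-- Arithmetic expressions. The result of an operation has at most one bit more than its two
operands together, so all intermediate results of a fixed expression have total binary length at
most linear in that of the entries and literals it uses; they change the space by a constant
factor only and are not charged. -/
inductive Expr where
  | lit (x : ℕ)
  | get (k : ℕ) (i : Expr)
  | add (a b : Expr)
  | sub (a b : Expr)
  | mul (a b : Expr)
  | div (a b : Expr)
  | mod (a b : Expr)
  | lt (a b : Expr)
  | eq (a b : Expr)

/-- The value of an expression; `sub` is truncated, and `lt` and `eq` return `1` for true and `0`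
for false. -/
def Expr.eval (m : Mem) : Expr → ℕ
  | lit x => x
  | get k i => m (k, i.eval m)
  | add a b => a.eval m + b.eval m
  | sub a b => a.eval m - b.eval m
  | mul a b => a.eval m * b.eval m
  | div a b => a.eval m / b.eval m
  | mod a b => a.eval m % b.eval m
  | lt a b => if a.eval m < b.eval m then 1 else 0
  | eq a b => if a.eval m = b.eval m then 1 else 0

/-- Programs. `assign k i e` sets entry `i` of array `k` to `e`, `flip k i` sets it to a fresh
random bit, `cond` branches, and `loop e p` repeats `p` while `e` is nonzero. -/
inductive Prog where
  | skip
  | assign (k : ℕ) (i e : Expr)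
  | flip (k : ℕ) (i : Expr)
  | seq (p q : Prog)
  | cond (e : Expr) (p q : Prog)
  | loop (e : Expr) (p : Prog)

/-- The memory together with the coin tosses that have not been used yet. A coin toss is read once
and can be used again only if the program has stored it. -/
abbrev Config : Type := Mem × (ℕ → Bool)

/-- `Exec S p c c'`: program `p`, started in configuration `c`, halts in configuration `c'`, and
after no step does the memory hold more than `S` bits. -/
inductive Exec (S : ℕ) : Prog → Config → Config → Prop
  | skip (c : Config) : Exec S Prog.skip c c
  | assign (k : ℕ) (i e : Expr) (m : Mem) (ω : ℕ → Bool)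
      (h : (m.write k (i.eval m) (e.eval m)).bits ≤ S) :
      Exec S (Prog.assign k i e) (m, ω) (m.write k (i.eval m) (e.eval m), ω)
  | flip (k : ℕ) (i : Expr) (m : Mem) (ω : ℕ → Bool)
      (h : (m.write k (i.eval m) (ω 0).toNat).bits ≤ S) :
      Exec S (Prog.flip k i) (m, ω) (m.write k (i.eval m) (ω 0).toNat, fun j => ω (j + 1))
  | seq (p q : Prog) (c₀ c₁ c₂ : Config) (hp : Exec S p c₀ c₁) (hq : Exec S q c₁ c₂) :
      Exec S (Prog.seq p q) c₀ c₂
  | cond_true (e : Expr) (p q : Prog) (c c' : Config) (he : e.eval c.1 ≠ 0) (hp : Exec S p c c') :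
      Exec S (Prog.cond e p q) c c'
  | cond_false (e : Expr) (p q : Prog) (c c' : Config) (he : e.eval c.1 = 0) (hq : Exec S q c c') :
      Exec S (Prog.cond e p q) c c'
  | loop_stop (e : Expr) (p : Prog) (c : Config) (he : e.eval c.1 = 0) :
      Exec S (Prog.loop e p) c c
  | loop_step (e : Expr) (p : Prog) (c₀ c₁ c₂ : Config) (he : e.eval c₀.1 ≠ 0)
      (hp : Exec S p c₀ c₁) (hl : Exec S (Prog.loop e p) c₁ c₂) :
      Exec S (Prog.loop e p) c₀ c₂

/-! Single-pass streaming algorithms. -/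

/-- A randomized single-pass streaming algorithm: a program run before the stream, a program run
once for each stream element, and a program run after the stream. -/
structure StreamAlg where
  start : Prog
  step : Prog
  finish : Prog

/-- The number that encodes the type of an update. -/
def Change.code : Change → ℕ
  | Change.insert Label.plus => 0
  | Change.remove Label.plus => 1
  | Change.insert Label.minus => 2
  | Change.remove Label.minus => 3

/-- A stream element `(u, v, Δ)` is presented by writing `u`, `v` and the code of `Δ` to entries
`1`, `2` and `3` of array `0`. -/
noncomputable def Mem.present {n : ℕ} (m : Mem) (x : StreamItem (Fin n)) : Mem :=
  ((m.write 0 1 x.u).write 0 2 x.v).write 0 3 x.change.code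

namespace StreamAlg

/-- Reading the stream, in the given order and once, with at most `S` bits of memory. -/
inductive Reads (A : StreamAlg) (S : ℕ) {n : ℕ} :
    List (StreamItem (Fin n)) → Config → Config → Prop
  | nil (c : Config) : Reads A S [] c c
  | cons (x : StreamItem (Fin n)) (σ : List (StreamItem (Fin n))) (m : Mem) (ω : ℕ → Bool)
      (c₁ c₂ : Config) (h : (m.present x).bits ≤ S) (hx : Exec S A.step (m.present x, ω) c₁)
      (hσ : Reads A S σ c₁ c₂) : Reads A S (x :: σ) (m, ω) c₂

/-- `A.Outputs S σ ω C`: on the stream `σ` over the vertices `0, …, n - 1` and the coin tosses `ω`,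
the algorithm halts, never holds more than `S` bits, and outputs the clustering `C`. At the start
entry `0` of array `0` holds `n` and the rest of the memory is zero; at the end entry `v` of
array `1` is the name of the cluster of the vertex `v`. -/
def Outputs (A : StreamAlg) (S : ℕ) {n : ℕ} (σ : List (StreamItem (Fin n))) (ω : ℕ → Bool)
    (C : Setoid (Fin n)) : Prop :=
  ∃ c₀ c₁ c₂ : Config,
    (Mem.write 0 0 0 n).bits ≤ S ∧
    Exec S A.start (Mem.write 0 0 0 n, ω) c₀ ∧
    A.Reads S σ c₀ c₁ ∧
    Exec S A.finish c₁ c₂ ∧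
    C = Setoid.ker fun v : Fin n => c₂.1 (1, (v : ℕ))

end StreamAlg

/-- The law of an infinite sequence of independent fair coin tosses. -/
noncomputable def coinTosses : Measure (ℕ → Bool) :=
  Measure.infinitePi fun _ : ℕ => (PMF.uniformOfFintype Bool).toMeasure

/-! ## Reasoning about programs -/

/-! An edge is a disagreement of a clustering exactly when one, and only one, of the two statements
"it carries `+`" and "it lies inside a cluster" holds. Modulo 2 the disagreement set is therefore
the sum of the `+`-edges, which depend on the stream only, and the pairs inside clusters, which are
known without the stream. If a random set of pairs is fixed in advance and the parity of its
`+`-edges is maintained, the parity of the disagreements in that set can be found afterwards for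
every clustering (`oddBit_sketch`). Insertions and removals both flip a parity, so the length of the
stream is irrelevant.

The sets are given by affine hash functions modulo `2 ^ B` with `B = logM n`; a sample on level `j`
contains a pair with probability `2 ^ -j`. Let `X` be the cost of a clustering. By the first moment
a sample is odd with probability at most `1/1024` if `2 ^ j ≥ 1024 X` (`oddSeeds_few`); by the
second moment it is odd with probability at least `1/32` if `8 X ≤ 2 ^ j ≤ 16 X` (`oddSeeds_many`).
The threshold of one sample in 128 separates the two cases, so the last level that reaches it
estimates `log X`, and a clustering that minimizes this estimate is a `1024 / 8 = 128`-approximation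
(`clusterCost_le`).

All `n ^ n` namings of clusters are tried; time is unrestricted, and one candidate needs only `O(n
log n)` bits. A level has `128 * quorum R n` samples with `quorum R n = R n B`, so a Chernoff bound
(`coinTosses_le_of_prod`) makes each estimate fail with probability at most `2 ^ -(R n B)`, which
survives the union bound over the candidates (`coinTosses_failure_le`). The `O(n B²)` seeds of `2 B`
bits dominate the space (`algSpace_le`).

The program is verified by Hoare-style rules: `Ok` is total correctness within a space bound, and
`Core` is the memory invariant that yields this bound. -/

theorem Mem.write_apply (m : Mem) (k i x k' i' : ℕ) :
    m.write k i x (k', i') = if k' = k ∧ i' = i then x else m (k', i') := by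
  classical
  simp [Mem.write, Finsupp.update_apply]

/-- Array `k` uses only entries below `w k`, and these have at most `b k` bits. -/
def Mem.Fits (w b : ℕ → ℕ) (m : Mem) : Prop :=
  ∀ k i, m (k, i) ≠ 0 → i < w k ∧ m (k, i) < 2 ^ b k

theorem Mem.Fits.write {w b : ℕ → ℕ} {m : Mem} (hm : m.Fits w b) {k i x : ℕ} (hi : i < w k)
    (hx : x < 2 ^ b k) : (m.write k i x).Fits w b := by
  intro k' i' h
  rw [Mem.write_apply] at h ⊢
  split_ifs at h ⊢ with h'
  · obtain ⟨rfl, rfl⟩ := h'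
    exact ⟨hi, hx⟩
  · exact hm _ _ h

/-- The number of bits that suffice for the first `T` arrays. -/
def space (w b : ℕ → ℕ) (T : ℕ) : ℕ := ∑ k ∈ Finset.range T, w k * (Nat.size (w k) + b k)

theorem Mem.Fits.bits_le {w b : ℕ → ℕ} {m : Mem} (hm : m.Fits w b) {T : ℕ}
    (hT : ∀ k, T ≤ k → w k = 0) : m.bits ≤ space w b T := by
  classical
  set U : Finset (ℕ × ℕ) := ((Finset.range T).sigma fun k => Finset.range (w k)).image
    fun a => (a.1, a.2) with hU
  have hsub : m.support ⊆ U := by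
    intro a ha
    obtain ⟨k, i⟩ := a
    have h := hm k i (Finsupp.mem_support_iff.1 ha)
    have hk : k < T := by
      by_contra hk
      have := hT k (not_lt.1 hk)
      omega
    exact Finset.mem_image.2 ⟨⟨k, i⟩, by simp [hk, h.1], rfl⟩
  have hinj : Function.Injective fun a : (_ : ℕ) × ℕ => (a.1, a.2) := by
    rintro ⟨a, b⟩ ⟨c, d⟩ h
    simp only [Prod.mk.injEq] at h
    obtain ⟨rfl, rfl⟩ := h
    rfl
  calc m.bits ≤ ∑ a ∈ m.support, (Nat.size (w a.1) + b a.1) := by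
        refine Finset.sum_le_sum fun a ha => ?_
        have h := hm a.1 a.2 (Finsupp.mem_support_iff.1 ha)
        exact add_le_add (Nat.size_le_size h.1.le) (Nat.size_le.2 h.2)
    _ ≤ ∑ a ∈ U, (Nat.size (w a.1) + b a.1) :=
        Finset.sum_le_sum_of_subset hsub
    _ = space w b T := by
        rw [hU, Finset.sum_image hinj.injOn, Finset.sum_sigma]
        simp [space]

/-- Started in `c`, the program `p` halts within space `S`, in a configuration that satisfies
`Q`. -/
def Ok (S : ℕ) (p : Prog) (c : Config) (Q : Config → Prop) : Prop := ∃ c', Exec S p c c' ∧ Q c'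

namespace Ok

variable {S : ℕ} {c : Config} {Q Q' : Config → Prop}

theorem imp {p : Prog} (h : Ok S p c Q) (hQ : ∀ c', Q c' → Q' c') : Ok S p c Q' :=
  let ⟨c', h, h'⟩ := h
  ⟨c', h, hQ _ h'⟩

theorem seq {p q : Prog} (h : Ok S p c fun c' => Ok S q c' Q) : Ok S (Prog.seq p q) c Q :=
  let ⟨_, h, c₂, h', hQ⟩ := h
  ⟨c₂, .seq _ _ _ _ _ h h', hQ⟩

theorem skip (h : Q c) : Ok S Prog.skip c Q := ⟨c, .skip c, h⟩

theorem cond {e : Expr} {p q : Prog} (h₁ : e.eval c.1 ≠ 0 → Ok S p c Q)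
    (h₂ : e.eval c.1 = 0 → Ok S q c Q) : Ok S (Prog.cond e p q) c Q := by
  by_cases he : e.eval c.1 = 0
  · obtain ⟨c', h, hQ⟩ := h₂ he
    exact ⟨c', .cond_false _ _ _ _ _ he h, hQ⟩
  · obtain ⟨c', h, hQ⟩ := h₁ he
    exact ⟨c', .cond_true _ _ _ _ _ he h, hQ⟩

theorem assign {k : ℕ} {i e : Expr} (hS : (c.1.write k (i.eval c.1) (e.eval c.1)).bits ≤ S)
    (h : Q (c.1.write k (i.eval c.1) (e.eval c.1), c.2)) : Ok S (Prog.assign k i e) c Q :=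
  ⟨_, .assign k i e c.1 c.2 hS, h⟩

theorem flip {k : ℕ} {i : Expr} (hS : (c.1.write k (i.eval c.1) (c.2 0).toNat).bits ≤ S)
    (h : Q (c.1.write k (i.eval c.1) (c.2 0).toNat, fun j => c.2 (j + 1))) :
    Ok S (Prog.flip k i) c Q :=
  ⟨_, .flip k i c.1 c.2 hS, h⟩

/-- A loop with the invariant `I` runs `T` rounds. -/
theorem loop {e : Expr} {p : Prog} (I : ℕ → Config → Prop) (T : ℕ)
    (hstep : ∀ t < T, ∀ c, I t c → e.eval c.1 ≠ 0 ∧ Ok S p c (I (t + 1)))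
    (hdone : ∀ c, I T c → e.eval c.1 = 0) (h : I 0 c) : Ok S (Prog.loop e p) c (I T) := by
  have key : ∀ d t, t + d = T → ∀ c, I t c → Ok S (Prog.loop e p) c (I T) := by
    intro d
    induction d with
    | zero =>
      rintro t rfl c h
      exact ⟨c, Exec.loop_stop _ _ _ (hdone _ h), h⟩
    | succ d ih =>
      intro t ht c h
      obtain ⟨he, c₁, h₁, hI⟩ := hstep t (by omega) c h
      obtain ⟨c₂, h₂, hQ⟩ := ih (t + 1) (by omega) c₁ hI
      exact ⟨c₂, .loop_step _ _ _ _ _ he h₁ h₂, hQ⟩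
  exact key T 0 (by omega) c h

end Ok

/-- The variable `i`: entry `i` of array `0`. -/
abbrev Expr.var (i : ℕ) : Expr := .get 0 (.lit i)

/-- Write the value of `e` to the variable `i`. -/
abbrev Prog.set (i : ℕ) (e : Expr) : Prog := .assign 0 (.lit i) e

/-- Repeat `p` for the values `0, 1, …` of the variable `i` as long as it is less than `e`. -/
def Prog.for (i : ℕ) (e : Expr) (p : Prog) : Prog :=
  .seq (.set i (.lit 0))
    (.loop (.lt (.var i) e) (.seq p (.set i (.add (.var i) (.lit 1)))))

/-- The rule for `for`-loops: `I t` is the invariant before round `t`. -/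
theorem Ok.for {S : ℕ} {c : Config} {i : ℕ} {e : Expr} {p : Prog} {Q : Config → Prop}
    (I : ℕ → Config → Prop) (T : ℕ)
    (h0 : (c.1.write 0 i 0).bits ≤ S ∧ I 0 (c.1.write 0 i 0, c.2))
    (he : ∀ t ≤ T, ∀ c, I t c → c.1 (0, i) = t ∧ e.eval c.1 = T)
    (hstep : ∀ t < T, ∀ c, I t c → Ok S p c fun c' => c'.1 (0, i) = t ∧
      (c'.1.write 0 i (t + 1)).bits ≤ S ∧ I (t + 1) (c'.1.write 0 i (t + 1), c'.2))
    (hQ : ∀ c, I T c → Q c) : Ok S (Prog.for i e p) c Q := by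
  refine Ok.seq (Ok.assign h0.1 (Ok.imp (Ok.loop I T (fun t ht c hc => ⟨?_, ?_⟩) ?_ h0.2) hQ))
  · have := he t ht.le c hc
    simp [Expr.eval, this, ht]
  · refine Ok.seq ((hstep t ht c hc).imp fun c' h => ?_)
    refine Ok.assign ?_ ?_
    · simpa [Expr.eval, h.1] using h.2.1
    · simpa [Expr.eval, h.1] using h.2.2
  · intro c hc
    have := he T le_rfl c hc
    simp [Expr.eval, this]

/-! ## The memory layout of the algorithm -/

/-- The hash values have `logM n` bits. -/
def logM (n : ℕ) : ℕ := Nat.clog 2 (16 * n ^ 4)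

/-- The number of odd samples on a level that the algorithm regards as many. -/
def quorum (R n : ℕ) : ℕ := R * (n * logM n)

/-- The number of samples on a level. -/
def cols (R n : ℕ) : ℕ := 128 * quorum R n

/-- The number of samples on all levels; level `j` consists of the samples `i` with
`i / cols R n = j`. -/
def cells (R n : ℕ) : ℕ := logM n * cols R n

/-- The number of bits of a variable. -/
def varBits (R n : ℕ) : ℕ := n * logM n + 4 * logM n + R + 8

/-- The number of entries of each array. -/
def width (R n : ℕ) : ℕ → ℕ
  | 0 => 17
  | 1 => n
  | 2 => cells R n
  | 3 => cells R n
  | 4 => logM n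
  | _ => 0

/-- The number of bits of the entries of each array. -/
def depth (R n : ℕ) : ℕ → ℕ
  | 0 => varBits R n
  | 1 => logM n
  | 2 => 2 * logM n
  | 3 => 1
  | 4 => logM n
  | _ => 0

/-- The space of the algorithm. -/
def algSpace (R n : ℕ) : ℕ := space (width R n) (depth R n) 5

theorem bits_le_algSpace {R n : ℕ} {m : Mem} (hm : m.Fits (width R n) (depth R n)) :
    m.bits ≤ algSpace R n :=
  hm.bits_le fun k hk => by
    obtain ⟨k, rfl⟩ := Nat.exists_eq_add_of_le' hk
    rfl

/-- The fourth power leaves room on every level that matters: there `2 ^ j ≤ 16 * n ^ 2`, so the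
accepted window of hash values, of length `2 ^ (logM n - j)`, is still at least `n ^ 2` and thus
exceeds every pair key. -/
theorem le_two_pow_logM (n : ℕ) : 16 * n ^ 4 ≤ 2 ^ logM n := Nat.le_pow_clog one_lt_two _

theorem sq_lt_two_pow_logM (n : ℕ) : n * n < 2 ^ logM n := by
  rcases Nat.eq_zero_or_pos n with rfl | hn
  · exact Nat.two_pow_pos _
  · refine lt_of_lt_of_le ?_ (le_two_pow_logM n)
    have : 0 < n * n := Nat.mul_pos hn hn
    nlinarith [Nat.mul_le_mul this this]

theorem lt_two_pow_logM (n : ℕ) : n < 2 ^ logM n := by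
  refine lt_of_le_of_lt ?_ (sq_lt_two_pow_logM n)
  exact Nat.le_mul_self n

theorem pow_lt_varBits {R n x k : ℕ} (hx : x < 2 ^ k) (hk : k ≤ varBits R n) :
    x < 2 ^ varBits R n :=
  hx.trans_le (Nat.pow_le_pow_right two_pos hk)

theorem two_pow_logM_lt (R n : ℕ) : 2 ^ logM n < 2 ^ varBits R n :=
  Nat.pow_lt_pow_right one_lt_two (by unfold varBits; omega)

theorem self_lt_varBits (R n : ℕ) : n < 2 ^ varBits R n :=
  (lt_two_pow_logM n).trans (two_pow_logM_lt R n)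

theorem sq_lt_varBits (R n : ℕ) : n * n < 2 ^ varBits R n :=
  (sq_lt_two_pow_logM n).trans (two_pow_logM_lt R n)

theorem logM_succ_lt_varBits (R n : ℕ) : 2 * logM n + 1 < 2 ^ varBits R n :=
  (Nat.lt_two_pow_self (n := 2 * logM n + 1)).trans_le
    (Nat.pow_le_pow_right two_pos (by unfold varBits; omega))

/-- This is what the term `n * logM n` in `varBits` is for: a single variable holds the number of an
entire clustering. -/
theorem pow_self_lt_varBits (R n : ℕ) : n ^ n < 2 ^ varBits R n := by
  refine pow_lt_varBits (k := n * logM n + 1) ?_ (by unfold varBits; omega)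
  calc n ^ n ≤ (2 ^ logM n) ^ n := Nat.pow_le_pow_left (lt_two_pow_logM n).le _
    _ = 2 ^ (n * logM n) := by rw [← pow_mul, mul_comm]
    _ < _ := Nat.pow_lt_pow_right one_lt_two (Nat.lt_succ_self _)

theorem quorum_lt (R n : ℕ) : quorum R n < 2 ^ (R + 2 * logM n) := by
  unfold quorum
  calc R * (n * logM n) < 2 ^ R * (2 ^ logM n * 2 ^ logM n) := by
        have h1 := lt_two_pow_logM n
        have h2 := Nat.lt_two_pow_self (n := logM n)
        have h3 := Nat.lt_two_pow_self (n := R)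
        exact Nat.mul_lt_mul'' h3 (Nat.mul_lt_mul'' h1 h2)
    _ = _ := by rw [pow_add, two_mul, pow_add]

theorem cols_lt_varBits (R n : ℕ) : cols R n < 2 ^ varBits R n := by
  refine pow_lt_varBits (k := 7 + (R + 2 * logM n)) ?_ (by unfold varBits; omega)
  rw [pow_add]
  exact Nat.mul_lt_mul_of_pos_left (quorum_lt R n) (by norm_num)

theorem cells_lt (R n : ℕ) : cells R n < 2 ^ (logM n + (7 + (R + 2 * logM n))) := by
  rw [pow_add, pow_add]
  exact Nat.mul_lt_mul'' Nat.lt_two_pow_self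
    (Nat.mul_lt_mul_of_pos_left (quorum_lt R n) (by norm_num))

theorem cells_lt_varBits (R n : ℕ) : cells R n < 2 ^ varBits R n :=
  pow_lt_varBits (cells_lt R n) (by unfold varBits; omega)

/-- The memory holds the parameters, the powers of two, the seeds `z`, the sketch `s` and the
cluster names `f`. -/
structure Core (R n : ℕ) (z s f : ℕ → ℕ) (m : Mem) : Prop where
  fits : m.Fits (width R n) (depth R n)
  size_eq : m (0, 0) = n
  modulus_eq : m (0, 4) = 2 ^ logM n
  log_eq : m (0, 5) = logM n
  pow_eq : ∀ j < logM n, m (4, j) = 2 ^ j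
  seed_eq : ∀ i < cells R n, m (2, i) = z i
  sketch_eq : ∀ i < cells R n, m (3, i) = s i
  name_eq : ∀ v < n, m (1, v) = f v

namespace Core

variable {R n : ℕ} {z s f : ℕ → ℕ} {m : Mem}

theorem congr (h : Core R n z s f m) {z' s' f' : ℕ → ℕ} (hz : ∀ i < cells R n, z i = z' i)
    (hs : ∀ i < cells R n, s i = s' i) (hf : ∀ v < n, f v = f' v) : Core R n z' s' f' m :=
  { h with
    seed_eq := fun i hi => (h.seed_eq i hi).trans (hz i hi)
    sketch_eq := fun i hi => (h.sketch_eq i hi).trans (hs i hi)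
    name_eq := fun v hv => (h.name_eq v hv).trans (hf v hv) }

/-- The entries 0, 4 and 5 are excluded because they hold `n`, the modulus and its logarithm, which
`Core` keeps fixed. -/
theorem write_var (h : Core R n z s f m) {i x : ℕ} (hi : i < 17 ∧ i ≠ 0 ∧ i ≠ 4 ∧ i ≠ 5)
    (hx : x < 2 ^ varBits R n) : Core R n z s f (m.write 0 i x) where
  fits := h.fits.write hi.1 hx
  size_eq := by simp [Mem.write_apply, hi.2.1.symm, h.size_eq]
  modulus_eq := by simp [Mem.write_apply, hi.2.2.1.symm, h.modulus_eq]
  log_eq := by simp [Mem.write_apply, hi.2.2.2.symm, h.log_eq]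
  pow_eq j hj := by simp [Mem.write_apply, h.pow_eq j hj]
  seed_eq j hj := by simp [Mem.write_apply, h.seed_eq j hj]
  sketch_eq j hj := by simp [Mem.write_apply, h.sketch_eq j hj]
  name_eq j hj := by simp [Mem.write_apply, h.name_eq j hj]

theorem write_name (h : Core R n z s f m) {v x : ℕ} (hv : v < n) (hx : x < 2 ^ logM n) :
    Core R n z s (Function.update f v x) (m.write 1 v x) where
  fits := h.fits.write hv hx
  size_eq := by simp [Mem.write_apply, h.size_eq]
  modulus_eq := by simp [Mem.write_apply, h.modulus_eq]
  log_eq := by simp [Mem.write_apply, h.log_eq]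
  pow_eq j hj := by simp [Mem.write_apply, h.pow_eq j hj]
  seed_eq j hj := by simp [Mem.write_apply, h.seed_eq j hj]
  sketch_eq j hj := by simp [Mem.write_apply, h.sketch_eq j hj]
  name_eq j hj := by simp [Mem.write_apply, Function.update_apply, h.name_eq j hj]

theorem write_seed (h : Core R n z s f m) {i x : ℕ} (hi : i < cells R n)
    (hx : x < 2 ^ (2 * logM n)) : Core R n (Function.update z i x) s f (m.write 2 i x) where
  fits := h.fits.write hi hx
  size_eq := by simp [Mem.write_apply, h.size_eq]
  modulus_eq := by simp [Mem.write_apply, h.modulus_eq]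
  log_eq := by simp [Mem.write_apply, h.log_eq]
  pow_eq j hj := by simp [Mem.write_apply, h.pow_eq j hj]
  seed_eq j hj := by simp [Mem.write_apply, Function.update_apply, h.seed_eq j hj]
  sketch_eq j hj := by simp [Mem.write_apply, h.sketch_eq j hj]
  name_eq j hj := by simp [Mem.write_apply, h.name_eq j hj]

theorem write_sketch (h : Core R n z s f m) {i x : ℕ} (hi : i < cells R n) (hx : x < 2) :
    Core R n z (Function.update s i x) f (m.write 3 i x) where
  fits := h.fits.write hi (by simpa [depth] using hx)
  size_eq := by simp [Mem.write_apply, h.size_eq]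
  modulus_eq := by simp [Mem.write_apply, h.modulus_eq]
  log_eq := by simp [Mem.write_apply, h.log_eq]
  pow_eq j hj := by simp [Mem.write_apply, h.pow_eq j hj]
  seed_eq j hj := by simp [Mem.write_apply, h.seed_eq j hj]
  sketch_eq j hj := by simp [Mem.write_apply, Function.update_apply, h.sketch_eq j hj]
  name_eq j hj := by simp [Mem.write_apply, h.name_eq j hj]

theorem bits_le (h : Core R n z s f m) : m.bits ≤ algSpace R n := bits_le_algSpace h.fits

theorem ok_set {c : Config} (h : Core R n z s f c.1) {Q : Config → Prop} {i : ℕ} {e : Expr}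
    {x : ℕ} (hi : i < 17 ∧ i ≠ 0 ∧ i ≠ 4 ∧ i ≠ 5) (he : e.eval c.1 = x)
    (hx : x < 2 ^ varBits R n)
    (hQ : Core R n z s f (c.1.write 0 i x) → Q (c.1.write 0 i x, c.2)) :
    Ok (algSpace R n) (Prog.set i e) c Q := by
  have h' := h.write_var hi hx
  subst he
  exact Ok.assign h'.bits_le (hQ h')

/-- A `for`-loop all of whose invariants keep the memory layout. -/
theorem ok_for {c : Config} (h : Core R n z s f c.1) {i : ℕ} {e : Expr} {p : Prog}
    {Q : Config → Prop} (hi : i < 17 ∧ i ≠ 0 ∧ i ≠ 4 ∧ i ≠ 5) (T : ℕ)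
    (hT : T < 2 ^ varBits R n) (Z S F : ℕ → ℕ → ℕ)
    (hZ : Z 0 = z) (hS : S 0 = s) (hF : F 0 = f)
    (I : ℕ → Config → Prop)
    (h0 : I 0 (c.1.write 0 i 0, c.2))
    (he : ∀ t ≤ T, ∀ c, Core R n (Z t) (S t) (F t) c.1 → I t c → e.eval c.1 = T)
    (hstep : ∀ t < T, ∀ c, Core R n (Z t) (S t) (F t) c.1 → c.1 (0, i) = t → I t c →
      Ok (algSpace R n) p c fun c' => Core R n (Z (t + 1)) (S (t + 1)) (F (t + 1)) c'.1 ∧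
        c'.1 (0, i) = t ∧ I (t + 1) (c'.1.write 0 i (t + 1), c'.2))
    (hQ : ∀ c, Core R n (Z T) (S T) (F T) c.1 → I T c → Q c) :
    Ok (algSpace R n) (Prog.for i e p) c Q := by
  subst hZ hS hF
  have h0' := h.write_var hi (Nat.two_pow_pos (varBits R n))
  refine Ok.for (fun t c => Core R n (Z t) (S t) (F t) c.1 ∧ c.1 (0, i) = t ∧ I t c) T
    ⟨h0'.bits_le, h0', by simp [Mem.write_apply], h0⟩
    (fun t ht c hc => ⟨hc.2.1, he t ht c hc.1 hc.2.2⟩) (fun t ht c hc => ?_)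
    (fun c hc => hQ c hc.1 hc.2.2)
  refine (hstep t ht c hc.1 hc.2.1 hc.2.2).imp fun c' h' => ?_
  have h1 := h'.1.write_var hi (lt_of_le_of_lt ht hT : t + 1 < _)
  exact ⟨h'.2.1, h1.bits_le, h1, by simp [Mem.write_apply], h'.2.2⟩

end Core

/-- Only the variables in `L` have changed. -/
def Mem.Agree (L : List ℕ) (m m' : Mem) : Prop := ∀ k, k ∉ L → m' (0, k) = m (0, k)

/-! ## The hash functions -/

/-- The hash value of `e` for the seed `a`. -/
def affineHash (B a e : ℕ) : ℕ := (a / 2 ^ B * e + a) % 2 ^ B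

/-- The seed `a` selects `e` at level `j`; a random seed does so with probability `2 ^ -j`. -/
def Hit (B j a e : ℕ) : Prop := affineHash B a e * 2 ^ j < 2 ^ B

instance (B j a e : ℕ) : Decidable (Hit B j a e) := inferInstanceAs (Decidable (_ < _))

/-- Numbers the unordered pairs of numbers less than `n`. -/
def pairKey (n u v : ℕ) : ℕ := if u < v then u * n + v else v * n + u

/-- `128 * R * n * log`. -/
def colsE (R : ℕ) : Expr := .mul (.lit 128) (.mul (.lit R) (.mul (.var 0) (.var 5)))

/-- Tests whether sample `i` contains `e`. -/
def hitE (R : ℕ) (i e : Expr) : Expr :=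
  .lt (.mul (.mod (.add (.mul (.div (.get 2 i) (.var 4)) e) (.get 2 i)) (.var 4))
    (.get 4 (.div i (colsE R)))) (.var 4)

theorem Core.eval_colsE {R n : ℕ} {z s f : ℕ → ℕ} {m : Mem} (h : Core R n z s f m) :
    (colsE R).eval m = cols R n := by
  simp [colsE, Expr.eval, h.size_eq, h.log_eq, cols, quorum]

theorem div_cols_lt {R n i : ℕ} (hi : i < cells R n) : i / cols R n < logM n :=
  Nat.div_lt_of_lt_mul (by rw [mul_comm]; exact hi)

/-- Expressions have no exponentiation, so the factor `2 ^ j` comes from the table in array 4; the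
level `j` is recovered from the sample index by division. -/
theorem Core.eval_hitE {R n : ℕ} {z s f : ℕ → ℕ} {m : Mem} (h : Core R n z s f m) {i e : Expr}
    (hi : i.eval m < cells R n) : (hitE R i e).eval m =
      if Hit (logM n) (i.eval m / cols R n) (z (i.eval m)) (e.eval m) then 1 else 0 := by
  simp [hitE, Expr.eval, h.eval_colsE, h.modulus_eq, h.seed_eq _ hi, h.pow_eq _ (div_cols_lt hi),
    Hit, affineHash]
  congr

/-! ## Processing a stream element -/

/-- The pair that the stream element concerns. -/
def keyE : Expr :=
  .add (.mul (.lt (.var 1) (.var 2)) (.add (.mul (.var 1) (.var 0)) (.var 2)))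
    (.mul (.sub (.lit 1) (.lt (.var 1) (.var 2))) (.add (.mul (.var 2) (.var 0)) (.var 1)))

theorem eval_keyE {m : Mem} {n u v : ℕ} (h0 : m (0, 0) = n) (h1 : m (0, 1) = u)
    (h2 : m (0, 2) = v) : keyE.eval m = pairKey n u v := by
  by_cases h : u < v <;> simp [keyE, Expr.eval, pairKey, *]

def cellsE (R : ℕ) : Expr := .mul (.var 5) (colsE R)

theorem Core.eval_cellsE {R n : ℕ} {z s f : ℕ → ℕ} {m : Mem} (h : Core R n z s f m) :
    (cellsE R).eval m = cells R n := by
  simp [cellsE, Expr.eval, h.eval_colsE, h.log_eq, cells]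

/-- If the stream element inserts or removes a label `+`, change the parities of all samples that
contain the pair. -/
def stepProg (R : ℕ) : Prog :=
  .for 6 (cellsE R) (.assign 3 (.var 6) (.mod (.add (.get 3 (.var 6))
    (.mul (hitE R (.var 6) keyE) (.lt (.var 3) (.lit 2)))) (.lit 2)))

theorem ok_stepProg {R n : ℕ} {z s f : ℕ → ℕ} {c : Config} (h : Core R n z s f c.1) :
    Ok (algSpace R n) (stepProg R) c fun c' => c'.2 = c.2 ∧ Core R n z (fun i => (s i +
      if Hit (logM n) (i / cols R n) (z i) (pairKey n (c.1 (0, 1)) (c.1 (0, 2))) ∧ c.1 (0, 3) < 2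
        then 1 else 0) % 2) f c'.1 := by
  set s' : ℕ → ℕ := fun i => (s i +
      if Hit (logM n) (i / cols R n) (z i) (pairKey n (c.1 (0, 1)) (c.1 (0, 2))) ∧ c.1 (0, 3) < 2
        then 1 else 0) % 2 with hs'
  refine h.ok_for (by simp) (cells R n) (cells_lt_varBits R n) (fun _ => z)
    (fun t i => if i < t then s' i else s i) (fun _ => f) rfl (by simp) rfl
    (fun t c' => c'.2 = c.2 ∧ ∀ i ∈ [1, 2, 3], c'.1 (0, i) = c.1 (0, i))
    (by simp [Mem.write_apply]) (fun t ht c' hc' hI => hc'.eval_cellsE) ?_ ?_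
  · rintro t ht ⟨m, ω⟩ hc ht' ⟨rfl, hI⟩
    simp only at hc ht' hI
    simp only [List.mem_cons, List.not_mem_nil, or_false, forall_eq_or_imp, forall_eq] at hI
    have hidx : (Expr.var 6).eval m = t := by simp [Expr.eval, ht']
    have hval : (Expr.mod (.add (.get 3 (.var 6))
        (.mul (hitE R (.var 6) keyE) (.lt (.var 3) (.lit 2)))) (.lit 2)).eval m = s' t := by
      have h1 := hc.eval_hitE (i := .var 6) (e := keyE) (by rw [hidx]; exact ht)
      rw [hidx, eval_keyE hc.size_eq hI.1 hI.2.1] at h1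
      have h2 := hc.sketch_eq t ht
      simp only [lt_irrefl, if_false] at h2
      have h3 : (Expr.lt (.var 3) (.lit 2)).eval m = if c.1 (0, 3) < 2 then 1 else 0 := by
        simp [Expr.eval, hI.2.2]
      have h4 : (Expr.get 3 (.var 6)).eval m = s t := by simp [Expr.eval, ht', h2]
      calc _ = ((Expr.get 3 (.var 6)).eval m + (hitE R (.var 6) keyE).eval m *
            (Expr.lt (.var 3) (.lit 2)).eval m) % 2 := rfl
        _ = _ := by
          rw [h1, h3, h4, hs']
          simp only [ite_and]
          split_ifs <;> simp
    have hw := hc.write_sketch ht (x := s' t) (Nat.mod_lt _ two_pos)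
    refine Ok.assign ?_ ⟨?_, ?_, ?_⟩
    · rw [hidx, hval]; exact hw.bits_le
    · rw [hidx, hval]
      refine hw.congr (fun _ _ => rfl) (fun i _ => ?_) (fun _ _ => rfl)
      rcases lt_trichotomy i t with h | rfl | h
      · simp [h.ne, h, Nat.lt_succ_of_lt h]
      · simp
      · simp [h.ne', not_lt.2 h.le, not_lt.2 (Nat.succ_le_of_lt h)]
    · simp [Mem.write_apply, ht']
    · simp [Mem.write_apply, hI.1, hI.2.1, hI.2.2]
  · rintro c' hc' ⟨h1, -⟩
    exact ⟨h1, hc'.congr (fun _ _ => rfl) (fun i hi => by simp [hi]) (fun _ _ => rfl)⟩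

/-! ## Initialization -/

/-- Compute the modulus, its logarithm, and the powers of two. -/
def powProg : Prog :=
  .seq (.set 4 (.lit 1)) (.loop
    (.lt (.var 4) (.mul (.lit 16) (.mul (.mul (.var 0) (.var 0)) (.mul (.var 0) (.var 0)))))
    (.seq (.assign 4 (.var 5) (.var 4))
      (.seq (.set 4 (.mul (.lit 2) (.var 4))) (.set 5 (.add (.var 5) (.lit 1))))))

theorem fits_init (R n : ℕ) : (Mem.write 0 0 0 n).Fits (width R n) (depth R n) :=
  Mem.Fits.write (fun k i h => absurd rfl h) (by simp [width]) (self_lt_varBits R n)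

theorem ok_powProg (R n : ℕ) (ω : ℕ → Bool) :
    Ok (algSpace R n) powProg (Mem.write 0 0 0 n, ω) fun c =>
      c.2 = ω ∧ Core R n (fun _ => 0) (fun _ => 0) (fun _ => 0) c.1 := by
  have hf := (fits_init R n).write (k := 0) (i := 4) (x := 1) (by simp [width])
    (Nat.one_lt_two_pow (by simp [depth, varBits]))
  refine Ok.seq (Ok.assign (bits_le_algSpace hf) (Ok.imp (Ok.loop (fun t c => c.2 = ω ∧
    c.1.Fits (width R n) (depth R n) ∧ c.1 (0, 0) = n ∧ c.1 (0, 4) = 2 ^ t ∧ c.1 (0, 5) = t ∧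
    (∀ j < t, c.1 (4, j) = 2 ^ j) ∧ ∀ k i, k ≠ 0 → k ≠ 4 → c.1 (k, i) = 0) (logM n) ?_ ?_
    ⟨rfl, hf, ?_⟩) ?_))
  · rintro t ht ⟨m, ω'⟩ ⟨rfl, hm, h0, h4, h5, hp, hz⟩
    simp only at hm h0 h4 h5 hp hz
    have hlt := Nat.pow_lt_of_lt_clog ht
    refine ⟨?_, ?_⟩
    · have : 2 ^ t < 16 * (n * n * (n * n)) := by
        convert hlt using 2
        ring
      simp [Expr.eval, h0, h4, this]
    · have f1 := hm.write (k := 4) (i := t) (x := 2 ^ t) ht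
        (Nat.pow_lt_pow_right one_lt_two ht)
      have f2 := f1.write (k := 0) (i := 4) (x := 2 ^ (t + 1)) (by simp [width])
        ((Nat.pow_le_pow_right two_pos ht).trans_lt (two_pow_logM_lt R n))
      have f3 := f2.write (k := 0) (i := 5) (x := t + 1) (by simp [width])
        ((show t + 1 < 2 * logM n + 1 by omega).trans (logM_succ_lt_varBits R n))
      refine Ok.seq (Ok.assign ?_ (Ok.seq (Ok.assign ?_ (Ok.assign ?_ ?_))))
      · simpa [Expr.eval, h4, h5] using bits_le_algSpace f1
      · simpa [Expr.eval, h4, h5, Mem.write_apply, ← pow_succ'] using bits_le_algSpace f2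
      · simpa [Expr.eval, h4, h5, Mem.write_apply, ← pow_succ'] using bits_le_algSpace f3
      · simp only [Expr.eval, h4, h5, Mem.write_apply]
        refine ⟨trivial, ?_, by simp [h0], by simp [pow_succ'], by simp, fun j hj => ?_, fun k i hk hk' => ?_⟩
        · simpa [pow_succ'] using f3
        · rcases Nat.lt_succ_iff_lt_or_eq.1 hj with hj | rfl
          · simp [hj.ne, hp j hj]
          · simp
        · simp [hk, hk', hz k i hk hk']
  · rintro ⟨m, ω'⟩ ⟨-, hm, h0, h4, h5, hp, hz⟩
    simp only at h0 h4
    have : ¬ 2 ^ logM n < 16 * (n * n * (n * n)) := by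
      rw [not_lt, show 16 * (n * n * (n * n)) = 16 * n ^ 4 by ring]
      exact le_two_pow_logM n
    simp [Expr.eval, h0, h4, this]
  · simp +contextual [Mem.write_apply, Expr.eval]
  · rintro ⟨m, ω'⟩ ⟨h, hm, h0, h4, h5, hp, hz⟩
    exact ⟨h, hm, h0, h4, h5, hp, fun i _ => hz _ _ (by simp) (by simp),
      fun i _ => hz _ _ (by simp) (by simp), fun i _ => hz _ _ (by simp) (by simp)⟩

/-- The number with the binary digits `ω a, …, ω (a + k - 1)`. -/
def bitsVal (ω : ℕ → Bool) (a : ℕ) : ℕ → ℕ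
  | 0 => 0
  | k + 1 => 2 * bitsVal ω a k + (ω (a + k)).toNat

theorem bitsVal_lt (ω : ℕ → Bool) (a k : ℕ) : bitsVal ω a k < 2 ^ k := by
  induction k with
  | zero => simp [bitsVal]
  | succ k ih =>
    have := Bool.toNat_le (ω (a + k))
    simp only [bitsVal, pow_succ]
    omega

/-- The seed of sample `i`. -/
def seed (n : ℕ) (ω : ℕ → Bool) (i : ℕ) : ℕ := bitsVal ω (i * (2 * logM n)) (2 * logM n)

/-- Draw the seeds. -/
def seedProg (R : ℕ) : Prog :=
  .for 6 (cellsE R) (.for 7 (.mul (.lit 2) (.var 5)) (.seq (.flip 0 (.lit 8))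
    (.assign 2 (.var 6) (.add (.mul (.lit 2) (.get 2 (.var 6))) (.var 8)))))

/-- Coins can be read only once, hence each seed is stored as it is drawn. The invariants record how
far the tape has advanced; distinct seeds use disjoint blocks of coins, which later gives their
independence. -/
theorem ok_seedProg {R n : ℕ} {c : Config}
    (h : Core R n (fun _ => 0) (fun _ => 0) (fun _ => 0) c.1) :
    Ok (algSpace R n) (seedProg R) c fun c' =>
      Core R n (seed n c.2) (fun _ => 0) (fun _ => 0) c'.1 := by
  set ω := c.2
  set Q := 2 * logM n with hQ
  refine h.ok_for (by simp) (cells R n) (cells_lt_varBits R n)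
    (fun t i => if i < t then seed n ω i else 0) (fun _ _ => 0) (fun _ _ => 0)
    (by simp) rfl rfl (fun t c' => c'.2 = fun j => ω (j + t * Q))
    (by simp [ω]) (fun t ht c' hc' hI => hc'.eval_cellsE) ?_ ?_
  · intro t ht c₁ hc₁ ht₁ hω
    have h0 : (2 : ℕ) ^ (2 * logM n) > 0 := Nat.two_pow_pos _
    refine hc₁.ok_for (by simp) Q
      ((Nat.lt_succ_self _).trans (logM_succ_lt_varBits R n))
      (fun k => Function.update (fun i => if i < t then seed n ω i else 0) t
        (bitsVal ω (t * Q) k)) (fun _ _ => 0) (fun _ _ => 0) ?_ rfl rfl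
      (fun k c' => c'.1 (0, 6) = t ∧ c'.2 = fun j => ω (j + (t * Q + k)))
      (by simp [Mem.write_apply, ht₁, hω]) (fun k hk c' hc' hI => ?_) ?_ ?_
    · funext i
      rcases eq_or_ne i t with rfl | hi
      · simp [bitsVal]
      · simp [hi]
    · simp [Expr.eval, hc'.log_eq, hQ]
    · rintro k hk ⟨m, ω'⟩ hc₂ hk' ⟨h6, rfl⟩
      simp only at hc₂ hk' h6
      have e1 := hc₂.write_var (i := 8) (x := (ω (t * Q + k)).toNat) (by simp)
        ((Bool.toNat_lt _).trans_le
          (by simpa using Nat.pow_le_pow_right two_pos (show 1 ≤ varBits R n by simp [varBits])))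
      have e2 := e1.write_seed ht (x := bitsVal ω (t * Q) (k + 1))
        ((bitsVal_lt _ _ _).trans_le (Nat.pow_le_pow_right two_pos hk))
      have h2 : m (2, t) = bitsVal ω (t * Q) k := by simpa using hc₂.seed_eq t ht
      refine Ok.seq (Ok.flip ?_ (Ok.assign ?_ ?_))
      · simpa [Expr.eval] using e1.bits_le
      · simpa [Expr.eval, Mem.write_apply, h6, h2, bitsVal] using e2.bits_le
      · simp only [Expr.eval, Mem.write_apply, h6]
        refine ⟨?_, by simp [hk'], by simp, ?_⟩
        · simpa [bitsVal, h2] using e2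
        · funext j
          congr 1
          ring
    · rintro c₂ hc₂ ⟨h6, hω₂⟩
      refine ⟨hc₂.congr (fun i _ => ?_) (fun _ _ => rfl) (fun _ _ => rfl), h6, ?_⟩
      · rcases lt_trichotomy i t with h | rfl | h
        · simp [h.ne, h, Nat.lt_succ_of_lt h]
        · simp [seed, hQ]
        · simp [h.ne', not_lt.2 h.le, not_lt.2 (Nat.succ_le_of_lt h)]
      · simp only [hω₂]
        funext j
        congr 1
        ring
  · rintro c' hc' -
    exact hc'.congr (fun i hi => by simp [hi]) (fun _ _ => rfl) (fun _ _ => rfl)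

def startProg (R : ℕ) : Prog := .seq powProg (seedProg R)

theorem ok_startProg (R n : ℕ) (ω : ℕ → Bool) :
    Ok (algSpace R n) (startProg R) (Mem.write 0 0 0 n, ω) fun c =>
      Core R n (seed n ω) (fun _ => 0) (fun _ => 0) c.1 := by
  refine Ok.seq ((ok_powProg R n ω).imp fun c hc => ?_)
  obtain ⟨h1, h2⟩ := hc
  exact h1 ▸ ok_seedProg h2

/-! ## Search for the best clustering -/

/-- Write the base-`n` digits of variable `i` to the array of cluster names. -/
def decodeProg (i : ℕ) : Prog :=
  .seq (.set 15 (.var i)) (.for 7 (.var 0) (.seq (.assign 1 (.var 7) (.mod (.var 15) (.var 0)))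
    (.set 15 (.div (.var 15) (.var 0)))))

/-- The base-`n` digits of `x`. -/
def digit (n x v : ℕ) : ℕ := x / n ^ v % n

theorem ok_decodeProg {R n : ℕ} {z s f : ℕ → ℕ} {c : Config} (h : Core R n z s f c.1) {i x : ℕ}
    (hi : c.1 (0, i) = x) (hx : x < n ^ n) :
    Ok (algSpace R n) (decodeProg i) c fun c' =>
      Core R n z s (digit n x) c'.1 ∧ c.1.Agree [7, 15] c'.1 := by
  have hxb := hx.trans (pow_self_lt_varBits R n)
  refine Ok.seq (h.ok_set (by simp) (x := x) (by simp [Expr.eval, hi]) hxb fun h1 => ?_)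
  refine h1.ok_for (by simp) n (self_lt_varBits R n) (fun _ => z) (fun _ => s)
    (fun t v => if v < t then digit n x v else f v) rfl rfl (by simp)
    (fun t c' => c'.1 (0, 15) = x / n ^ t ∧ c.1.Agree [7, 15] c'.1) ?_ ?_ ?_ ?_
  · refine ⟨by simp [Mem.write_apply], fun k hk => ?_⟩
    simp only [List.mem_cons, List.not_mem_nil, or_false, not_or] at hk
    simp [Mem.write_apply, hk.1, hk.2]
  · intro t ht c' hc' hI
    simp [Expr.eval, hc'.size_eq]
  · rintro t ht ⟨m, ω⟩ hc ht' ⟨h15, hA⟩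
    simp only at hc ht' h15 hA
    have e1 := hc.write_name ht (x := digit n x t)
      ((Nat.mod_lt _ (by omega)).trans (lt_two_pow_logM n))
    have hd : x / n ^ t % n = digit n x t := rfl
    refine Ok.seq (Ok.assign ?_ ?_)
    · simpa [Expr.eval, ht', h15, hc.size_eq, hd] using e1.bits_le
    · simp only [Expr.eval, ht', h15, hc.size_eq, hd]
      refine e1.ok_set (by simp) (x := x / n ^ (t + 1)) ?_
        ((Nat.div_le_self _ _).trans_lt hxb) fun e2 => ?_
      · simp [Expr.eval, Mem.write_apply, h15, hc.size_eq, Nat.div_div_eq_div_mul, pow_succ]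
      · refine ⟨e2.congr (fun _ _ => rfl) (fun _ _ => rfl) fun v hv => ?_,
          by simp [Mem.write_apply, ht'], by simp [Mem.write_apply], fun k hk => ?_⟩
        · rcases lt_trichotomy v t with h | rfl | h
          · simp [h.ne, h, Nat.lt_succ_of_lt h]
          · simp
          · simp [h.ne', not_lt.2 h.le, not_lt.2 (Nat.succ_le_of_lt h)]
        · have := hA k hk
          simp only [List.mem_cons, List.not_mem_nil, or_false, not_or] at hk
          simpa [Mem.write_apply, hk.1, hk.2] using this
  · rintro c' hc' ⟨-, hA⟩
    exact ⟨hc'.congr (fun _ _ => rfl) (fun _ _ => rfl) fun v hv => by simp [hv], hA⟩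

/-- The index of sample `i` on level `j`. -/
def idxE (R : ℕ) : Expr := .add (.mul (.var 16) (colsE R)) (.var 6)

/-- The parity of the number of disagreements in a sample. -/
def oddBit (R n : ℕ) (z s f : ℕ → ℕ) (i : ℕ) : ℕ :=
  (s i + ∑ e ∈ Finset.range (n * n), if Hit (logM n) (i / cols R n) (z i) e ∧ e / n < e % n ∧
    f (e / n) = f (e % n) then 1 else 0) % 2

def sameE : Expr :=
  .mul (.lt (.div (.var 7) (.var 0)) (.mod (.var 7) (.var 0)))
    (.eq (.get 1 (.div (.var 7) (.var 0))) (.get 1 (.mod (.var 7) (.var 0))))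

/-- Compute the parity of the number of disagreements in a sample. -/
def bitProg (R : ℕ) : Prog :=
  .seq (.set 8 (.mod (.get 3 (idxE R)) (.lit 2)))
    (.for 7 (.mul (.var 0) (.var 0))
      (.set 8 (.mod (.add (.var 8) (.mul (hitE R (idxE R) (.var 7)) sameE)) (.lit 2))))

theorem two_lt_varBits (R n : ℕ) : 2 < 2 ^ varBits R n :=
  pow_lt_varBits (k := 2) (by norm_num) (by unfold varBits; omega)

theorem Core.eval_idxE {R n : ℕ} {z s f : ℕ → ℕ} {m : Mem} (h : Core R n z s f m) :
    (idxE R).eval m = m (0, 16) * cols R n + m (0, 6) := by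
  simp [idxE, Expr.eval, h.eval_colsE]

/-- Among the codes `e < n * n`, those with `e / n < e % n` are the keys of the unordered pairs,
each occurring once; the other codes must contribute nothing. -/
theorem Core.eval_sameE {R n : ℕ} {z s f : ℕ → ℕ} {m : Mem} (h : Core R n z s f m) {e : ℕ}
    (he : e < n * n) (h7 : m (0, 7) = e) :
    sameE.eval m = if e / n < e % n ∧ f (e / n) = f (e % n) then 1 else 0 := by
  have hn : 0 < n := by
    by_contra hn
    obtain rfl : n = 0 := by omega
    simp at he
  simp only [sameE, Expr.eval, h7, h.size_eq, h.name_eq _ (Nat.div_lt_of_lt_mul he),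
    h.name_eq _ (Nat.mod_lt _ hn), ite_and]
  split_ifs <;> rfl

theorem ok_bitProg {R n : ℕ} {z s f : ℕ → ℕ} {c : Config} (h : Core R n z s f c.1) {i : ℕ}
    (hi : c.1 (0, 16) * cols R n + c.1 (0, 6) = i) (hiN : i < cells R n) :
    Ok (algSpace R n) (bitProg R) c fun c' =>
      Core R n z s f c'.1 ∧ c.1.Agree [7, 8] c'.1 ∧ c'.1 (0, 8) = oddBit R n z s f i := by
  refine Ok.seq (h.ok_set (by simp) (x := s i % 2) ?_
    ((Nat.mod_lt _ two_pos).trans (two_lt_varBits R n)) fun h1 => ?_)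
  · have := h.eval_idxE
    simp only [hi] at this
    simp [Expr.eval, this, h.sketch_eq i hiN]
  refine h1.ok_for (by simp) (n * n) (sq_lt_varBits R n) (fun _ => z) (fun _ => s) (fun _ => f)
    rfl rfl rfl (fun t c' => c.1.Agree [7, 8] c'.1 ∧ c'.1 (0, 8) = (s i + ∑ e ∈ Finset.range t,
      if Hit (logM n) (i / cols R n) (z i) e ∧ e / n < e % n ∧ f (e / n) = f (e % n)
        then 1 else 0) % 2) ?_ ?_ ?_ ?_
  · refine ⟨fun k hk => ?_, by simp [Mem.write_apply]⟩
    simp only [List.mem_cons, List.not_mem_nil, or_false, not_or] at hk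
    simp [Mem.write_apply, hk.1, hk.2]
  · intro t ht c' hc' hI
    simp [Expr.eval, hc'.size_eq]
  · rintro t ht ⟨m, ω⟩ hc ht' ⟨hA, h8⟩
    simp only at hc ht' h8 hA
    have hidx : (idxE R).eval m = i := by
      rw [hc.eval_idxE, hA 16 (by simp), hA 6 (by simp), hi]
    have e1 := hc.eval_hitE (i := idxE R) (e := .var 7) (by rw [hidx]; exact hiN)
    have e2 := hc.eval_sameE ht ht'
    rw [hidx, show (Expr.var 7).eval m = t from ht'] at e1
    refine hc.ok_set (by simp) rfl ((Nat.mod_lt _ two_pos).trans (two_lt_varBits R n))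
      fun h2 => ⟨h2, by simp [Mem.write_apply, ht'], fun k hk => ?_, ?_⟩
    · have := hA k hk
      simp only [List.mem_cons, List.not_mem_nil, or_false, not_or] at hk
      simpa [Mem.write_apply, hk.1, hk.2] using this
    · have e3 : (Expr.mod (.add (.var 8) (.mul (hitE R (idxE R) (.var 7)) sameE)) (.lit 2)).eval m
          = (m (0, 8) + (hitE R (idxE R) (.var 7)).eval m * sameE.eval m) % 2 := rfl
      simp only [Mem.write_apply]
      rw [if_neg (by simp), if_pos (by simp), e3, e1, e2, h8, Finset.sum_range_succ,
        ← add_assoc, Nat.mod_add_mod]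
      congr 2
      simp only [ite_and]
      split_ifs <;> rfl
  · rintro c' hc' ⟨hA, h8⟩
    exact ⟨hc', hA, h8⟩

/-- Count the samples on a level with an odd number of disagreements. -/
def levelProg (R : ℕ) : Prog :=
  .seq (.set 9 (.lit 0)) (.for 6 (colsE R) (.seq (bitProg R) (.set 9 (.add (.var 9) (.var 8)))))

/-- The number of samples on level `j` with an odd number of disagreements. -/
def oddCount (R n : ℕ) (z s f : ℕ → ℕ) (j : ℕ) : ℕ :=
  ∑ i ∈ Finset.range (cols R n), oddBit R n z s f (j * cols R n + i)

theorem oddBit_le_one (R n : ℕ) (z s f : ℕ → ℕ) (i : ℕ) : oddBit R n z s f i ≤ 1 :=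
  Nat.le_of_lt_succ (Nat.mod_lt _ two_pos)

theorem ok_levelProg {R n : ℕ} {z s f : ℕ → ℕ} {c : Config} (h : Core R n z s f c.1) {j : ℕ}
    (hj : c.1 (0, 16) = j) (hjB : j < logM n) :
    Ok (algSpace R n) (levelProg R) c fun c' =>
      Core R n z s f c'.1 ∧ c.1.Agree [6, 7, 8, 9] c'.1 ∧
        c'.1 (0, 9) = oddCount R n z s f j := by
  refine Ok.seq (h.ok_set (by simp) (x := 0) rfl (Nat.two_pow_pos _) fun h1 => ?_)
  refine h1.ok_for (by simp) (cols R n) (cols_lt_varBits R n) (fun _ => z) (fun _ => s)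
    (fun _ => f) rfl rfl rfl (fun t c' => c.1.Agree [6, 7, 8, 9] c'.1 ∧ c'.1 (0, 9) =
      ∑ i ∈ Finset.range t, oddBit R n z s f (j * cols R n + i)) ?_ ?_ ?_ ?_
  · refine ⟨fun k hk => ?_, by simp [Mem.write_apply]⟩
    simp only [List.mem_cons, List.not_mem_nil, or_false, not_or] at hk
    simp [Mem.write_apply, hk]
  · exact fun t ht c' hc' hI => hc'.eval_colsE
  · rintro t ht c₁ hc ht' ⟨hA, h9⟩
    have hlt : j * cols R n + t < cells R n := by
      have := Nat.mul_le_mul_right (cols R n) (Nat.succ_le_of_lt hjB)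
      unfold cells
      rw [Nat.succ_mul] at this
      omega
    have h16 : c₁.1 (0, 16) = j := by rw [hA 16 (by simp), hj]
    refine Ok.seq ((ok_bitProg hc (by rw [h16, ht']) hlt).imp ?_)
    rintro c₂ ⟨hc₂, hA₂, h8⟩
    have hsum : c₂.1 (0, 9) + c₂.1 (0, 8) =
        ∑ i ∈ Finset.range (t + 1), oddBit R n z s f (j * cols R n + i) := by
      rw [hA₂ 9 (by simp), h9, h8, Finset.sum_range_succ]
    refine hc₂.ok_set (by simp) (e := .add (.var 9) (.var 8)) hsum ?_
      fun h2 => ⟨h2, ?_, fun k hk => ?_, ?_⟩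
    · refine lt_of_le_of_lt ?_ (cols_lt_varBits R n)
      refine (Finset.sum_le_card_nsmul _ _ 1 fun i _ => oddBit_le_one _ _ _ _ _ _).trans ?_
      simpa using ht
    · simp [Mem.write_apply, hA₂ 6 (by simp), ht']
    · have h3 := hA k hk
      have h4 := hA₂ k (by simp only [List.mem_cons, List.not_mem_nil, or_false] at hk ⊢; tauto)
      simp only [List.mem_cons, List.not_mem_nil, or_false, not_or] at hk
      simp [Mem.write_apply, hk, h3, h4]
    · simp [Mem.write_apply]
  · rintro c' hc' ⟨hA, h9⟩
    exact ⟨hc', hA, h9⟩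

/-- One plus the last of the numbers `j < B` with `q ≤ N j`, or `0` if there is none. -/
def lastLevel (q : ℕ) (N : ℕ → ℕ) : ℕ → ℕ
  | 0 => 0
  | j + 1 => if q ≤ N j then j + 1 else lastLevel q N j

theorem lastLevel_le (q : ℕ) (N : ℕ → ℕ) (B : ℕ) : lastLevel q N B ≤ B := by
  induction B with
  | zero => exact le_rfl
  | succ B ih =>
    simp only [lastLevel]
    split_ifs <;> omega

/-- Together with `exists_of_lastLevel_pos` this is all that the approximation guarantee uses about
scores. The counts need not be monotone in the level. -/
theorem le_lastLevel {q : ℕ} {N : ℕ → ℕ} {B j : ℕ} (hj : j < B) (hq : q ≤ N j) :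
    j + 1 ≤ lastLevel q N B := by
  induction B with
  | zero => omega
  | succ B ih =>
    simp only [lastLevel]
    split_ifs with h
    · omega
    · rcases Nat.lt_succ_iff_lt_or_eq.1 hj with hj | rfl
      · exact ih hj
      · exact absurd hq h

theorem exists_of_lastLevel_pos {q : ℕ} {N : ℕ → ℕ} {B : ℕ} (h : lastLevel q N B ≠ 0) :
    ∃ j < B, lastLevel q N B = j + 1 ∧ q ≤ N j := by
  induction B with
  | zero => exact absurd rfl h
  | succ B ih =>
    simp only [lastLevel] at h ⊢
    split_ifs at h ⊢ with hq
    · exact ⟨B, Nat.lt_succ_self B, rfl, hq⟩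
    · obtain ⟨j, hj, h⟩ := ih h
      exact ⟨j, Nat.lt_succ_of_lt hj, h⟩

def quorumE (R : ℕ) : Expr := .mul (.lit R) (.mul (.var 0) (.var 5))

/-- Compute the last level with many samples with an odd number of disagreements. -/
def scoreProg (R : ℕ) : Prog :=
  .seq (.set 10 (.lit 0)) (.for 16 (.var 5) (.seq (levelProg R)
    (.cond (.lt (.var 9) (quorumE R)) .skip (.set 10 (.add (.var 16) (.lit 1))))))

/-- A logarithmic estimate of the cost of the clustering with the cluster names `f`. -/
def score (R n : ℕ) (z s f : ℕ → ℕ) : ℕ :=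
  lastLevel (quorum R n) (oddCount R n z s f) (logM n)

theorem ok_scoreProg {R n : ℕ} {z s f : ℕ → ℕ} {c : Config} (h : Core R n z s f c.1) :
    Ok (algSpace R n) (scoreProg R) c fun c' =>
      Core R n z s f c'.1 ∧ c.1.Agree [6, 7, 8, 9, 10, 16] c'.1 ∧
        c'.1 (0, 10) = score R n z s f := by
  have hB := logM_succ_lt_varBits R n
  refine Ok.seq (h.ok_set (by simp) (x := 0) rfl (Nat.two_pow_pos _) fun h1 => ?_)
  refine h1.ok_for (by simp) (logM n) (by omega) (fun _ => z) (fun _ => s)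
    (fun _ => f) rfl rfl rfl (fun t c' => c.1.Agree [6, 7, 8, 9, 10, 16] c'.1 ∧ c'.1 (0, 10) =
      lastLevel (quorum R n) (oddCount R n z s f) t) ?_ ?_ ?_ ?_
  · refine ⟨fun k hk => ?_, by simp [Mem.write_apply, lastLevel]⟩
    simp only [List.mem_cons, List.not_mem_nil, or_false, not_or] at hk
    simp [Mem.write_apply, hk]
  · exact fun t ht c' hc' hI => hc'.log_eq
  · rintro t ht c₁ hc ht' ⟨hA, h10⟩
    refine Ok.seq ((ok_levelProg hc ht' ht).imp ?_)
    rintro c₂ ⟨hc₂, hA₂, h9⟩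
    have hA₃ : c.1.Agree [6, 7, 8, 9, 10, 16] c₂.1 := fun k hk => by
      rw [← hA k hk, hA₂ k (by
        simp only [List.mem_cons, List.not_mem_nil, or_false] at hk ⊢; tauto)]
    have h16 : c₂.1 (0, 16) = t := by rw [hA₂ 16 (by simp), ht']
    have hc9 : (Expr.lt (.var 9) (quorumE R)).eval c₂.1 =
        if oddCount R n z s f t < quorum R n then 1 else 0 := by
      simp [Expr.eval, quorumE, hc₂.size_eq, hc₂.log_eq, h9, quorum]
      congr
    refine Ok.cond (fun he => Ok.skip ⟨hc₂, h16, fun k hk => ?_, ?_⟩) (fun he => ?_)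
    · rw [← hA₃ k hk]
      simp only [List.mem_cons, List.not_mem_nil, or_false, not_or] at hk
      simp [Mem.write_apply, hk]
    · have : ¬ quorum R n ≤ oddCount R n z s f t := by
        by_contra h
        rw [hc9, if_neg (not_lt.2 h)] at he
        exact he rfl
      simp [Mem.write_apply, hA₂ 10 (by simp), h10, lastLevel, this]
    · have : quorum R n ≤ oddCount R n z s f t := by
        by_contra h
        rw [hc9, if_pos (not_le.1 h)] at he
        exact one_ne_zero he
      refine hc₂.ok_set (by simp) (e := .add (.var 16) (.lit 1)) (x := t + 1)
        (by simp [Expr.eval, h16]) (by omega) fun h2 => ⟨h2, ?_, fun k hk => ?_, ?_⟩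
      · simp [Mem.write_apply, h16]
      · rw [← hA₃ k hk]
        simp only [List.mem_cons, List.not_mem_nil, or_false, not_or] at hk
        simp [Mem.write_apply, hk]
      · simp [Mem.write_apply, lastLevel, this]
  · rintro c' hc' ⟨hA, h10⟩
    exact ⟨hc', hA, h10⟩

/-- Compute `n ^ n`. -/
def selfPowProg : Prog :=
  .seq (.set 14 (.lit 1)) (.for 7 (.var 0) (.set 14 (.mul (.var 14) (.var 0))))

theorem ok_selfPowProg {R n : ℕ} {z s f : ℕ → ℕ} {c : Config} (h : Core R n z s f c.1) :
    Ok (algSpace R n) selfPowProg c fun c' => Core R n z s f c'.1 ∧ c'.1 (0, 14) = n ^ n := by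
  refine Ok.seq (h.ok_set (by simp) (x := 1) rfl ((two_lt_varBits R n).trans' one_lt_two)
    fun h1 => ?_)
  refine h1.ok_for (by simp) n (self_lt_varBits R n) (fun _ => z) (fun _ => s)
    (fun _ => f) rfl rfl rfl (fun t c' => c'.1 (0, 14) = n ^ t) (by simp [Mem.write_apply])
    (fun t ht c' hc' hI => hc'.size_eq) (fun t ht c' hc ht' hI => ?_) (fun c' hc' h' => ⟨hc', h'⟩)
  refine hc.ok_set (by simp) (x := n ^ (t + 1)) (by simp [Expr.eval, hI, hc.size_eq, pow_succ])
    ((Nat.pow_le_pow_right (by omega) ht).trans_lt (pow_self_lt_varBits R n)) fun h2 => ⟨h2, ?_, ?_⟩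
  · simp [Mem.write_apply, ht']
  · simp [Mem.write_apply]

/-- Output the clustering with the least score. -/
def finishProg (R : ℕ) : Prog :=
  .seq selfPowProg (.seq (.set 12 (.lit 0)) (.seq (.set 13 (.add (.var 5) (.lit 1)))
    (.seq (.for 11 (.var 14) (.seq (decodeProg 11) (.seq (scoreProg R)
      (.cond (.lt (.var 10) (.var 13)) (.seq (.set 12 (.var 11)) (.set 13 (.var 10))) .skip))))
      (decodeProg 12))))

theorem ok_finishProg {R n : ℕ} (hn : 0 < n) {z s f : ℕ → ℕ} {c : Config}
    (h : Core R n z s f c.1) :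
    Ok (algSpace R n) (finishProg R) c fun c' => ∃ x < n ^ n, (∀ v < n, c'.1 (1, v) = digit n x v) ∧
      ∀ y < n ^ n, score R n z s (digit n x) ≤ score R n z s (digit n y) := by
  have hB := logM_succ_lt_varBits R n
  have hP : 0 < n ^ n := Nat.pow_pos hn
  refine Ok.seq ((ok_selfPowProg h).imp fun c₁ ⟨h1, h14⟩ => ?_)
  refine Ok.seq (h1.ok_set (by simp) (x := 0) rfl (Nat.two_pow_pos _) fun h2 => ?_)
  -- Scores are at most `logM n`, so this initial record is beaten by the first candidate and cannot
  -- survive the search.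
  refine Ok.seq (h2.ok_set (by simp) (x := logM n + 1)
    (by simp [Expr.eval, Mem.write_apply, h1.log_eq]) (by omega) fun h3 => Ok.seq ?_)
  refine h3.ok_for (by simp) (n ^ n) (pow_self_lt_varBits R n) (fun _ => z) (fun _ => s)
    -- Decoding overwrites the cluster names in every round, so they belong to the latest candidate;
    -- the best one is decoded again at the end.
    (fun | 0 => f | t + 1 => digit n t) rfl rfl rfl
    (fun t c' => c'.1 (0, 14) = n ^ n ∧ c'.1 (0, 12) < n ^ n ∧
      (c'.1 (0, 13) = logM n + 1 ∨ c'.1 (0, 13) = score R n z s (digit n (c'.1 (0, 12)))) ∧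
      ∀ y < t, c'.1 (0, 13) ≤ score R n z s (digit n y))
    (by simp [Mem.write_apply, h14, hP]) (fun t ht c' hc' hI => hI.1) ?_ ?_
  · rintro t ht c₁ hc ht' ⟨h14, h12, h13, hmin⟩
    refine Ok.seq ((ok_decodeProg hc ht' ht).imp fun c₂ ⟨hc₂, hA₂⟩ => ?_)
    refine Ok.seq ((ok_scoreProg hc₂).imp fun c₃ ⟨hc₃, hA₃, h10⟩ => ?_)
    have e11 : c₃.1 (0, 11) = t := by rw [hA₃ 11 (by simp), hA₂ 11 (by simp), ht']
    have e12 : c₃.1 (0, 12) = c₁.1 (0, 12) := by rw [hA₃ 12 (by simp), hA₂ 12 (by simp)]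
    have e13 : c₃.1 (0, 13) = c₁.1 (0, 13) := by rw [hA₃ 13 (by simp), hA₂ 13 (by simp)]
    have e14 : c₃.1 (0, 14) = n ^ n := by rw [hA₃ 14 (by simp), hA₂ 14 (by simp), h14]
    have hlt : (Expr.lt (.var 10) (.var 13)).eval c₃.1 =
        if score R n z s (digit n t) < c₁.1 (0, 13) then 1 else 0 := by
      simp [Expr.eval, h10, e13]
    refine Ok.cond (fun he => ?_) (fun he => Ok.skip ⟨hc₃, e11, ?_⟩)
    · have hs : score R n z s (digit n t) < c₁.1 (0, 13) := by
        by_contra h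
        rw [hlt, if_neg h] at he
        exact he rfl
      have hle : score R n z s (digit n t) ≤ logM n := lastLevel_le _ _ _
      refine Ok.seq (hc₃.ok_set (by simp) (e := .var 11) (x := t) e11
        (ht.trans (pow_self_lt_varBits R n)) fun h4 => ?_)
      refine h4.ok_set (by simp) (x := score R n z s (digit n t))
        (by simp [Expr.eval, Mem.write_apply, h10]) (by omega) fun h5 => ⟨h5, ?_, ?_, ?_, ?_, ?_⟩
      · simp [Mem.write_apply, e11]
      · simp [Mem.write_apply, e14]
      · simp [Mem.write_apply, ht]
      · simp [Mem.write_apply]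
      · intro y hy
        simp only [Mem.write_apply]
        rcases Nat.lt_succ_iff_lt_or_eq.1 hy with hy | rfl
        · simpa using hs.le.trans (hmin y hy)
        · simp
    · have hs : c₁.1 (0, 13) ≤ score R n z s (digit n t) := by
        by_contra h
        rw [hlt, if_pos (not_le.1 h)] at he
        exact one_ne_zero he
      refine ⟨?_, ?_, ?_, ?_⟩
      · simp [Mem.write_apply, e14]
      · simp [Mem.write_apply, e12, h12]
      · simpa [Mem.write_apply, e12, e13] using h13
      · intro y hy
        simp only [Mem.write_apply]
        rcases Nat.lt_succ_iff_lt_or_eq.1 hy with hy | rfl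
        · simpa [e13] using hmin y hy
        · simpa [e13] using hs
  · rintro c₁ hc ⟨h14, h12, h13, hmin⟩
    refine (ok_decodeProg hc rfl h12).imp fun c₂ ⟨hc₂, _⟩ => ⟨_, h12, hc₂.name_eq, ?_⟩
    have hle : score R n z s (digit n 0) ≤ logM n := lastLevel_le _ _ _
    have := hmin 0 hP
    rcases h13 with h13 | h13
    · omega
    · rw [← h13]
      exact hmin

/-! ## The sketch of a labeled graph -/

/-- The number of an unordered pair of vertices. -/
def edgeKey {n : ℕ} (e : Sym2 (Fin n)) : ℕ := e.inf * n + e.sup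

theorem edgeKey_mk {n : ℕ} {u v : Fin n} (h : u ≠ v) : edgeKey s(u, v) = pairKey n u v := by
  rcases lt_or_gt_of_ne h with h | h
  · have h' : (u : ℕ) < v := h
    simp [edgeKey, pairKey, h', inf_eq_left.2 h.le, sup_eq_right.2 h.le]
  · have h' : ¬ (u : ℕ) < v := not_lt.2 h.le
    simp [edgeKey, pairKey, h', inf_eq_right.2 h.le, sup_eq_left.2 h.le]

theorem edgeKey_lt {n : ℕ} (e : Sym2 (Fin n)) : edgeKey e < n * n := by
  have h1 := e.inf.isLt
  have h2 := e.sup.isLt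
  unfold edgeKey
  nlinarith

theorem edgeKey_injective (n : ℕ) : Function.Injective (edgeKey (n := n)) := by
  intro e e' h
  have h1 := e.sup.isLt
  have h2 := e'.sup.isLt
  have hn : 0 < n := by omega
  unfold edgeKey at h
  refine Sym2.inf_eq_inf_and_sup_eq_sup.1 ⟨Fin.ext ?_, Fin.ext ?_⟩
  · have := congrArg (· / n) h
    simpa [Nat.add_div hn, Nat.div_eq_of_lt h1, Nat.div_eq_of_lt h2, hn, Nat.mod_eq_of_lt h1,
      Nat.mod_eq_of_lt h2, not_le.2 h1, not_le.2 h2] using this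
  · have := congrArg (· % n) h
    simpa [Nat.mod_eq_of_lt h1, Nat.mod_eq_of_lt h2] using this

/-- The parity of the number of pairs in `F` that the seed `a` selects at level `j`. -/
def parity {n : ℕ} (B j a : ℕ) (F : Finset (Sym2 (Fin n))) : ℕ :=
  (F.filter fun e => Hit B j a (edgeKey e)).card % 2

theorem parity_insert {n : ℕ} (B j a : ℕ) {F : Finset (Sym2 (Fin n))} {e : Sym2 (Fin n)}
    (he : e ∉ F) :
    parity B j a (insert e F) =
      (parity B j a F + if Hit B j a (edgeKey e) then 1 else 0) % 2 := by
  unfold parity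
  rw [Finset.filter_insert]
  split_ifs
  · rw [Finset.card_insert_of_notMem (by simp [he])]
    simp
  · simp

open Classical in
/-- The pairs that carry the label `+`. -/
noncomputable def plusSet {n : ℕ} (H : Sym2 (Fin n) → Option Label) : Finset (Sym2 (Fin n)) :=
  Finset.univ.filter fun e => ¬ e.IsDiag ∧ H e = some Label.plus

/-- The sketch of the labels `H` for the seeds `z`. -/
noncomputable def sketch {n : ℕ} (R : ℕ) (z : ℕ → ℕ) (H : Sym2 (Fin n) → Option Label) (i : ℕ) :
    ℕ :=
  parity (logM n) (i / cols R n) (z i) (plusSet H)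

/-- An update of the label `+` flips the samples that contain the pair. Legality is essential: it
ensures that an inserted pair was absent and a removed one present. Updates of `-` leave the set of
`+`-pairs alone, as the pair has no `+` before or after. -/
theorem sketch_apply {n : ℕ} (R : ℕ) (z : ℕ → ℕ) {H : Sym2 (Fin n) → Option Label}
    {x : StreamItem (Fin n)} (hx : x.Allowed H) (i : ℕ) :
    sketch R z (x.apply H) i = (sketch R z H i + if Hit (logM n) (i / cols R n) (z i)
      (pairKey n x.u x.v) ∧ x.change.code < 2 then 1 else 0) % 2 := by
  classical
  obtain ⟨u, v, Δ⟩ := x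
  obtain ⟨huv, hΔ⟩ := hx
  simp only at huv hΔ
  have hle : sketch R z H i < 2 := Nat.mod_lt _ two_pos
  rw [← edgeKey_mk huv]
  unfold sketch
  set H' := StreamItem.apply H ⟨u, v, Δ⟩ with hH'
  rcases Δ with (_ | _) | (_ | _)
  · have : plusSet H' = insert s(u, v) (plusSet H) := by
      ext e
      by_cases he : e = s(u, v)
      · simp [plusSet, hH', StreamItem.apply, he, huv]
      · simp [plusSet, hH', StreamItem.apply, he]
    rw [this, parity_insert _ _ _ (by simp [plusSet, hΔ])]
    simp [Change.code]
  · have : plusSet H' = plusSet H := by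
      ext e
      by_cases he : e = s(u, v)
      · subst he; simp [plusSet, hH', StreamItem.apply, hΔ]
      · simp [plusSet, hH', StreamItem.apply, he]
    rw [this]
    simp [Change.code, parity]
  -- A removal is an insertion read backwards, and modulo 2 both are the same flip.
  · have : plusSet H = insert s(u, v) (plusSet H') := by
      ext e
      by_cases he : e = s(u, v)
      · subst he; simp [plusSet, hΔ, huv]
      · simp [plusSet, hH', StreamItem.apply, he]
    rw [this, parity_insert _ _ _ (by simp [plusSet, hH', StreamItem.apply])]
    have hlt : parity (logM n) (i / cols R n) (z i) (plusSet H') < 2 := Nat.mod_lt _ two_pos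
    simp only [Change.code]
    split_ifs <;> simp_all <;> omega
  · have : plusSet H' = plusSet H := by
      ext e
      by_cases he : e = s(u, v)
      · subst he; simp [plusSet, hH', StreamItem.apply, hΔ]
      · simp [plusSet, hH', StreamItem.apply, he]
    rw [this]
    simp [Change.code, parity]

theorem sketch_empty {n : ℕ} (R : ℕ) (z : ℕ → ℕ) (i : ℕ) :
    sketch R z (fun _ : Sym2 (Fin n) => none) i = 0 := by
  simp [sketch, plusSet, parity]

theorem code_lt (Δ : Change) : Δ.code < 4 := by
  rcases Δ with (_ | _) | (_ | _) <;> simp [Change.code]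

/-- The streaming algorithm with the parameter `R`. -/
def clusterAlg (R : ℕ) : StreamAlg where
  start := startProg R
  step := stepProg R
  finish := finishProg R

/-- The sketch is a function of the seeds and the current labels alone, not of the history that led
to them; this makes the induction on the stream work and the space independent of its length. -/
theorem exists_reads {n R : ℕ} {z f : ℕ → ℕ} {G : LabeledGraph (Fin n)}
    (σ : List (StreamItem (Fin n))) : ∀ (H : Sym2 (Fin n) → Option Label) (c : Config),
    LeadsTo G H σ → Core R n z (sketch R z H) f c.1 →
    ∃ (c' : Config) (H' : Sym2 (Fin n) → Option Label),
      (clusterAlg R).Reads (algSpace R n) σ c c' ∧ Core R n z (sketch R z H') f c'.1 ∧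
        ∀ e : (⊤ : SimpleGraph (Fin n)).edgeSet, H' e = some (G e) := by
  induction σ with
  | nil => exact fun H c hH hc => ⟨c, H, .nil c, hc, hH⟩
  | cons x σ ih =>
    rintro H ⟨m, ω⟩ ⟨hx, hH⟩ hc
    have hn := self_lt_varBits R n
    have e1 := ((hc.write_var (i := 1) (x := x.u) (by simp) (x.u.isLt.trans hn)).write_var
      (i := 2) (x := x.v) (by simp) (x.v.isLt.trans hn)).write_var
      (i := 3) (x := x.change.code) (by simp) ((code_lt _).trans
        (pow_lt_varBits (k := 3) (by norm_num) (by unfold varBits; omega)))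
    obtain ⟨c₁, h1, -, h2⟩ := ok_stepProg (c := (m.present x, ω)) e1
    have h3 : Core R n z (sketch R z (x.apply H)) f c₁.1 := by
      refine h2.congr (fun _ _ => rfl) (fun i _ => ?_) (fun _ _ => rfl)
      rw [sketch_apply R z hx]
      simp [Mem.present, Mem.write_apply]
    obtain ⟨c', H', h4, h5⟩ := ih _ c₁ hH h3
    exact ⟨c', H', .cons x σ m ω c₁ c' e1.bits_le h1 h4, h5⟩

/-! ## Disagreements -/

open Classical in
/-- The edges on which the clustering `C` disagrees with the labels of `G`. -/
noncomputable def disagreements {n : ℕ} (G : LabeledGraph (Fin n)) (C : Setoid (Fin n)) :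
    Finset (Sym2 (Fin n)) :=
  (Finset.univ.filter fun e => edgeCost G C e = 1).map (Function.Embedding.subtype _)

theorem mem_disagreements {n : ℕ} {G : LabeledGraph (Fin n)} {C : Setoid (Fin n)}
    {e : Sym2 (Fin n)} (he : e ∈ (⊤ : SimpleGraph (Fin n)).edgeSet) :
    e ∈ disagreements G C ↔ edgeCost G C ⟨e, he⟩ = 1 := by
  classical
  unfold disagreements
  rw [Finset.mem_map]
  constructor
  · rintro ⟨⟨e', h'⟩, h, rfl⟩
    exact (Finset.mem_filter.1 h).2
  · exact fun h => ⟨⟨e, he⟩, Finset.mem_filter.2 ⟨Finset.mem_univ _, h⟩, rfl⟩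

theorem edgeCost_le_one {V : Type*} (G : LabeledGraph V) (C : Setoid V)
    (e : (⊤ : SimpleGraph V).edgeSet) : edgeCost G C e ≤ 1 := by
  unfold edgeCost
  split <;> split_ifs <;> simp

theorem card_disagreements {n : ℕ} (G : LabeledGraph (Fin n)) (C : Setoid (Fin n)) :
    (disagreements G C).card = clusterCost G C := by
  classical
  unfold disagreements clusterCost
  rw [Finset.card_map, Finset.card_filter]
  refine Finset.sum_congr (by congr!) fun e _ => ?_
  have := edgeCost_le_one G C e
  split_ifs <;> omega

theorem sum_range_mul_self {n : ℕ} (g : ℕ → ℕ) :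
    ∑ e ∈ Finset.range (n * n), g e = ∑ p : Fin n × Fin n, g (p.1 * n + p.2) := by
  rw [Finset.sum_range, ← finProdFinEquiv.sum_comp]
  refine Finset.sum_congr rfl fun p _ => ?_
  simp [finProdFinEquiv, add_comm, mul_comm]

open Classical in
theorem sum_pairs_eq {n : ℕ} (P : ℕ → Prop) (f : ℕ → ℕ) :
    (∑ e ∈ Finset.range (n * n), if P e ∧ e / n < e % n ∧ f (e / n) = f (e % n) then 1 else 0) =
      ∑ e : Sym2 (Fin n), if P (edgeKey e) ∧ ¬ e.IsDiag ∧
        Together (Setoid.ker fun v : Fin n => f v) e then 1 else 0 := by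
  have h := Finset.sum_sym2_filter_not_isDiag (Finset.univ : Finset (Fin n))
    (fun e => if P (edgeKey e) ∧ Together (Setoid.ker fun v : Fin n => f v) e then 1 else 0)
  rw [sum_range_mul_self]
  trans ∑ i ∈ Finset.univ.sym2 with ¬ i.IsDiag,
    if P (edgeKey i) ∧ Together (Setoid.ker fun v : Fin n => f v) i then 1 else 0
  · rw [h, Finset.sum_filter, ← Finset.sum_subset (Finset.subset_univ _)]
    · refine Finset.sum_congr rfl fun p hp => ?_
      obtain ⟨u, v⟩ := p
      have huv : u ≠ v := by simpa using hp
      have hn : 0 < n := u.pos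
      have h1 : ((u : ℕ) * n + v) / n = u := by
        rw [mul_comm, Nat.mul_add_div hn, Nat.div_eq_of_lt v.isLt, add_zero]
      have h2 : ((u : ℕ) * n + v) % n = v := by
        rw [mul_comm, Nat.mul_add_mod, Nat.mod_eq_of_lt v.isLt]
      simp only [h1, h2, Fin.val_fin_lt]
      by_cases hlt : u < v
      · have hT : Together (Setoid.ker fun v : Fin n => f v) s(u, v) ↔ f u = f v := by
          simp only [Together, Sym2.mem_iff, Setoid.ker_def]
          constructor
          · intro h
            exact h u (Or.inl rfl) v (Or.inr rfl)
          · rintro h a (rfl | rfl) b (rfl | rfl) <;> simp [h]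
        have hlt' : (u : ℕ) < v := hlt
        simp [hlt, hT, edgeKey_mk huv, pairKey, hlt']
      · simp [hlt]
    · rintro ⟨u, v⟩ - hp
      have huv : u = v := by simpa using hp
      subst huv
      have hn : 0 < n := u.pos
      have h1 : ((u : ℕ) * n + u) / n = u := by
        rw [mul_comm, Nat.mul_add_div hn, Nat.div_eq_of_lt u.isLt, add_zero]
      have h2 : ((u : ℕ) * n + u) % n = u := by
        rw [mul_comm, Nat.mul_add_mod, Nat.mod_eq_of_lt u.isLt]
      simp [h1, h2]
  · rw [Finset.sum_filter, Finset.sym2_univ]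
    refine Finset.sum_congr rfl fun e _ => ?_
    by_cases h1 : e.IsDiag <;> simp [h1]

/-- The disagreements are the symmetric difference of the `+`-edges and the pairs inside clusters.
The two sums are compared pair by pair modulo 2; diagonal pairs contribute to neither side. -/
theorem oddBit_sketch {n R : ℕ} {z f : ℕ → ℕ} {G : LabeledGraph (Fin n)}
    {H : Sym2 (Fin n) → Option Label}
    (hH : ∀ e : (⊤ : SimpleGraph (Fin n)).edgeSet, H e = some (G e)) (i : ℕ) :
    oddBit R n z (sketch R z H) f i = parity (logM n) (i / cols R n) (z i)
      (disagreements G (Setoid.ker fun v : Fin n => f v)) := by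
  classical
  have h1 := sum_pairs_eq (n := n) (Hit (logM n) (i / cols R n) (z i)) f
  unfold oddBit sketch parity
  rw [Nat.mod_add_mod]
  have h2 : (∑ e ∈ Finset.range (n * n), if Hit (logM n) (i / cols R n) (z i) e ∧
      e / n < e % n ∧ f (e / n) = f (e % n) then 1 else 0) = _ :=
    (Finset.sum_congr rfl fun _ _ => by congr).trans h1
  have h3 : ∀ F : Finset (Sym2 (Fin n)),
      (F.filter fun e => Hit (logM n) (i / cols R n) (z i) (edgeKey e)).card = ∑ e : Sym2 (Fin n),
        if e ∈ F ∧ Hit (logM n) (i / cols R n) (z i) (edgeKey e) then 1 else 0 := fun F => by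
    rw [← Finset.card_filter]
    congr 1
    ext e
    simp
  rw [h2, h3, h3, ← Finset.sum_add_distrib, Finset.sum_nat_mod, Finset.sum_nat_mod _ _ (fun e =>
    if e ∈ disagreements G _ ∧ Hit (logM n) (i / cols R n) (z i) (edgeKey e) then 1 else 0)]
  congr 1
  refine Finset.sum_congr rfl fun e _ => ?_
  by_cases hd : e.IsDiag
  · simp [hd, plusSet, disagreements]
  · have he : e ∈ (⊤ : SimpleGraph (Fin n)).edgeSet := by simpa using hd
    have hHe := hH ⟨e, he⟩
    simp only at hHe
    simp only [plusSet, Finset.mem_filter, Finset.mem_univ, true_and, hHe, hd, not_false_iff,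
      mem_disagreements he, Option.some.injEq, edgeCost]
    cases G ⟨e, he⟩ <;> by_cases h4 : Hit (logM n) (i / cols R n) (z i) (edgeKey e) <;>
      by_cases h5 : Together (Setoid.ker fun v : Fin n => f v) e <;> simp [h4, h5]

/-! ## Counting seeds -/

theorem card_filter_range_mul_self (M : ℕ) (P : ℕ → ℕ → Prop) [∀ a b, Decidable (P a b)] :
    ((Finset.range (M * M)).filter fun s => P (s / M) (s % M)).card =
      ∑ a ∈ Finset.range M, ((Finset.range M).filter fun b => P a b).card := by
  rw [Finset.card_filter, sum_range_mul_self, Fintype.sum_prod_type, Finset.sum_range]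
  refine Finset.sum_congr rfl fun a _ => ?_
  rw [Finset.card_filter, Finset.sum_range]
  refine Finset.sum_congr rfl fun b _ => ?_
  have hM : 0 < M := a.pos
  have h1 : ((a : ℕ) * M + b) / M = a := by
    rw [mul_comm, Nat.mul_add_div hM, Nat.div_eq_of_lt b.isLt, add_zero]
  have h2 : ((a : ℕ) * M + b) % M = b := by
    rw [mul_comm, Nat.mul_add_mod, Nat.mod_eq_of_lt b.isLt]
  simp only [h1, h2]

theorem card_filter_add_mod_lt (c : ℕ) {M W : ℕ} (hW : W ≤ M) :
    ((Finset.range M).filter fun b => (c + b) % M < W).card = W := by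
  have h := Nat.filter_Ico_card_eq_of_periodic c M (fun x => x % M < W)
    (fun x => by simp)
  rw [← Finset.card_map (addLeftEmbedding c)]
  trans ((Finset.Ico c (c + M)).filter fun x => x % M < W).card
  · congr 1
    ext x
    simp only [Finset.mem_map, Finset.mem_filter, Finset.mem_range, addLeftEmbedding_apply,
      Finset.mem_Ico]
    constructor
    · rintro ⟨b, ⟨h1, h2⟩, rfl⟩
      exact ⟨by omega, h2⟩
    · rintro ⟨h1, h2⟩
      exact ⟨x - c, ⟨by omega, by rwa [Nat.add_sub_cancel' h1.1]⟩, by omega⟩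
  · rw [h, Nat.count_eq_card_filter_range]
    trans (Finset.range W).card
    · congr 1
      ext x
      simp only [Finset.mem_filter, Finset.mem_range]
      constructor
      · rintro ⟨h1, h2⟩
        rwa [Nat.mod_eq_of_lt h1] at h2
      · intro h1
        exact ⟨by omega, by rwa [Nat.mod_eq_of_lt (by omega)]⟩
    · simp

/-- Few multiples of `d` fall into a window modulo `M`. -/
theorem card_filter_mul_mod_window {M d : ℕ} (hd : 0 < d) (lo W : ℕ) :
    ((Finset.range M).filter fun a => lo ≤ a * d % M ∧ a * d % M < lo + W).card ≤ W + d := by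
  have hcard : (Finset.range d ×ˢ Finset.range (W / d + 1)).card ≤ W + d := by
    rw [Finset.card_product, Finset.card_range, Finset.card_range, mul_add, mul_one]
    have := Nat.mul_div_le W d
    omega
  -- The first coordinate is the number of turns modulo `M` that `a * d` has completed, which is
  -- less than `d`. Within one turn the multiples of `d` are `d` apart, so the second coordinate,
  -- the block of length `d` inside the window, identifies `a`.
  refine le_trans (Finset.card_le_card_of_injOn
    (fun a => (a * d / M, (a * d % M - lo) / d)) ?_ ?_) hcard
  · intro a ha
    simp only [Finset.coe_filter, Finset.mem_range, Set.mem_ofPred_eq] at ha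
    simp only [Finset.coe_product, Finset.coe_range, Set.mem_prod, Set.mem_Iio]
    refine ⟨Nat.div_lt_of_lt_mul (Nat.mul_lt_mul_of_pos_right ha.1 hd), Nat.lt_succ_of_le ?_⟩
    exact Nat.div_le_div_right (by omega)
  · intro a ha b hb hab
    simp only [Finset.coe_filter, Finset.mem_range, Set.mem_ofPred_eq] at ha hb
    simp only [Prod.mk.injEq] at hab
    have ea := Nat.div_add_mod (a * d) M
    have eb := Nat.div_add_mod (b * d) M
    have qa := Nat.div_add_mod (a * d % M - lo) d
    have qb := Nat.div_add_mod (b * d % M - lo) d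
    have ra := Nat.mod_lt (a * d % M - lo) hd
    have rb := Nat.mod_lt (b * d % M - lo) hd
    rw [hab.1] at ea
    rw [hab.2] at qa
    have h1 : a * d < (b + 1) * d := by rw [Nat.succ_mul]; omega
    have h2 : b * d < (a + 1) * d := by rw [Nat.succ_mul]; omega
    have h3 := Nat.lt_of_mul_lt_mul_right h1
    have h4 := Nat.lt_of_mul_lt_mul_right h2
    omega

theorem hit_iff {B j s e : ℕ} (hj : j ≤ B) :
    Hit B j s e ↔ (s / 2 ^ B * e + s % 2 ^ B) % 2 ^ B < 2 ^ (B - j) := by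
  have h : (2 : ℕ) ^ B = 2 ^ (B - j) * 2 ^ j := by rw [← pow_add, Nat.sub_add_cancel hj]
  unfold Hit affineHash
  rw [Nat.add_mod_mod]
  constructor
  · intro h1
    rw [h] at h1
    rw [h]
    exact Nat.lt_of_mul_lt_mul_right h1
  · intro h1
    calc _ < 2 ^ (B - j) * 2 ^ j := Nat.mul_lt_mul_of_pos_right h1 (Nat.two_pow_pos _)
      _ = _ := h.symm

theorem card_hit {B j : ℕ} (hj : j ≤ B) (e : ℕ) :
    ((Finset.range (2 ^ B * 2 ^ B)).filter fun s => Hit B j s e).card = 2 ^ B * 2 ^ (B - j) := by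
  simp only [hit_iff hj]
  rw [card_filter_range_mul_self (2 ^ B) fun a b => (a * e + b) % 2 ^ B < 2 ^ (B - j)]
  rw [Finset.sum_congr rfl fun a _ => card_filter_add_mod_lt (a * e)
    (Nat.pow_le_pow_right two_pos (Nat.sub_le B j))]
  simp

/-- A substitute for pairwise independence, which fails modulo a power of two. If both hash values
lie below `W`, their difference `a * d` lies within `W` of 0 modulo `M`, that is, in one of two
windows of length `W`. Since `d ≤ W`, at most `2 * (W + d) ≤ 4 * W` multipliers `a` qualify, each
with at most `W` offsets. -/
theorem card_hit_and_hit_of_lt {B j : ℕ} (hj : j ≤ B) {e e' : ℕ} (he : e < e')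
    (hd : e' ≤ 2 ^ (B - j)) :
    ((Finset.range (2 ^ B * 2 ^ B)).filter fun s => Hit B j s e ∧ Hit B j s e').card ≤
      4 * (2 ^ (B - j) * 2 ^ (B - j)) := by
  simp only [hit_iff hj]
  set M := 2 ^ B with hM
  set W := 2 ^ (B - j) with hW
  have hWM : W ≤ M := Nat.pow_le_pow_right two_pos (Nat.sub_le B j)
  rw [card_filter_range_mul_self M fun a b => (a * e + b) % M < W ∧ (a * e' + b) % M < W]
  set d := e' - e with hd'
  set U := ((Finset.range M).filter fun a => 0 ≤ a * d % M ∧ a * d % M < 0 + W) ∪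
    ((Finset.range M).filter fun a => M - W ≤ a * d % M ∧ a * d % M < M - W + W) with hU
  have hUc : U.card ≤ 4 * W := by
    have h1 := card_filter_mul_mod_window (M := M) (d := d) (by omega) 0 W
    have h2 := card_filter_mul_mod_window (M := M) (d := d) (by omega) (M - W) W
    refine (Finset.card_union_le _ _).trans ?_
    omega
  have hMpos : 0 < M := Nat.two_pow_pos _
  calc _ ≤ ∑ a ∈ Finset.range M, if a ∈ U then W else 0 := by
        refine Finset.sum_le_sum fun a ha => ?_
        split_ifs with haU
        · refine le_trans (Finset.card_le_card ?_) (card_filter_add_mod_lt (a * e) hWM).le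
          exact Finset.monotone_filter_right _ fun b _ h => h.1
        · rw [Nat.le_zero, Finset.card_eq_zero, Finset.filter_eq_empty_iff]
          rintro b - ⟨h1, h2⟩
          refine haU ?_
          have e1 : a * e' + b = (a * e + b) + a * d := by
            have : e' = e + d := by omega
            rw [this]
            ring
          rw [e1, Nat.add_mod] at h2
          have hr := Nat.mod_lt (a * d) hMpos
          rw [hU, Finset.mem_union, Finset.mem_filter, Finset.mem_filter]
          by_cases hlt : (a * e + b) % M + a * d % M < M
          · rw [Nat.mod_eq_of_lt hlt] at h2
            exact Or.inl ⟨ha, by omega, by omega⟩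
          · exact Or.inr ⟨ha, by omega, by omega⟩
    _ ≤ U.card * W := by
        rw [← Finset.sum_filter, Finset.sum_const, smul_eq_mul]
        refine Nat.mul_le_mul_right _ (Finset.card_le_card fun a ha => ?_)
        exact (Finset.mem_filter.1 ha).2
    _ ≤ _ := by
        rw [← mul_assoc]
        exact Nat.mul_le_mul_right _ hUc

theorem card_hit_and_hit {B j : ℕ} (hj : j ≤ B) {e e' : ℕ} (he : e ≠ e')
    (h1 : e ≤ 2 ^ (B - j)) (h2 : e' ≤ 2 ^ (B - j)) :
    ((Finset.range (2 ^ B * 2 ^ B)).filter fun s => Hit B j s e ∧ Hit B j s e').card ≤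
      4 * (2 ^ (B - j) * 2 ^ (B - j)) := by
  rcases lt_or_gt_of_ne he with h | h
  · exact card_hit_and_hit_of_lt hj h h2
  · simp only [and_comm (a := Hit B j _ e)]
    exact card_hit_and_hit_of_lt hj h h1

/-! ### Probability that a sample is odd: first and second moments -/

/-- The number of seeds for which an odd number of elements of `F` is selected. -/
def oddSeeds {n : ℕ} (B j : ℕ) (F : Finset (Sym2 (Fin n))) : ℕ :=
  ((Finset.range (2 ^ B * 2 ^ B)).filter fun s => parity B j s F = 1).card

theorem sum_card_hit {n : ℕ} {B j : ℕ} (hj : j ≤ B) (F : Finset (Sym2 (Fin n))) :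
    ∑ s ∈ Finset.range (2 ^ B * 2 ^ B), (F.filter fun e => Hit B j s (edgeKey e)).card =
      F.card * (2 ^ B * 2 ^ (B - j)) := by
  simp only [Finset.card_filter]
  rw [Finset.sum_comm]
  simp only [← Finset.card_filter, card_hit hj, Finset.sum_const, smul_eq_mul]

theorem oddSeeds_le {n : ℕ} {B j : ℕ} (hj : j ≤ B) (F : Finset (Sym2 (Fin n))) :
    oddSeeds B j F ≤ F.card * (2 ^ B * 2 ^ (B - j)) := by
  rw [← sum_card_hit hj, oddSeeds, Finset.card_filter]
  refine Finset.sum_le_sum fun s _ => ?_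
  unfold parity
  split_ifs <;> omega

/-- Every natural number `k` satisfies `k ≤ (k mod 2) + k * (k - 1)`. With `k` the number of
selected elements, the last term counts ordered pairs of distinct selected elements; summing over
all seeds gives the bound. -/
theorem le_oddSeeds_add {n : ℕ} {B j : ℕ} (hj : j ≤ B) (hn : n * n ≤ 2 ^ (B - j))
    (F : Finset (Sym2 (Fin n))) :
    F.card * (2 ^ B * 2 ^ (B - j)) ≤
      oddSeeds B j F + F.card * F.card * (4 * (2 ^ (B - j) * 2 ^ (B - j))) := by
  classical
  have hpair : ∑ s ∈ Finset.range (2 ^ B * 2 ^ B),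
      ((F.filter fun e => Hit B j s (edgeKey e)).offDiag).card ≤
        F.card * F.card * (4 * (2 ^ (B - j) * 2 ^ (B - j))) := by
    calc _ = ∑ s ∈ Finset.range (2 ^ B * 2 ^ B), ∑ p ∈ F.offDiag,
          if Hit B j s (edgeKey p.1) ∧ Hit B j s (edgeKey p.2) then 1 else 0 := by
          refine Finset.sum_congr rfl fun s _ => ?_
          rw [← Finset.card_filter]
          congr 1
          ext p
          simp only [Finset.mem_offDiag, Finset.mem_filter]
          tauto
      _ = ∑ p ∈ F.offDiag, ((Finset.range (2 ^ B * 2 ^ B)).filter fun s =>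
          Hit B j s (edgeKey p.1) ∧ Hit B j s (edgeKey p.2)).card := by
          rw [Finset.sum_comm]
          simp only [Finset.card_filter]
      _ ≤ F.offDiag.card • (4 * (2 ^ (B - j) * 2 ^ (B - j))) := by
          refine Finset.sum_le_card_nsmul _ _ _ fun p hp => ?_
          refine card_hit_and_hit hj ?_ ((edgeKey_lt _).le.trans hn) ((edgeKey_lt _).le.trans hn)
          exact fun h => (Finset.mem_offDiag.1 hp).2.2 (edgeKey_injective n h)
      _ ≤ _ := by
          rw [smul_eq_mul, Finset.offDiag_card]
          exact Nat.mul_le_mul_right _ (Nat.sub_le _ _)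
  refine le_trans ?_ (Nat.add_le_add_left hpair _)
  rw [← sum_card_hit hj, oddSeeds, Finset.card_filter, ← Finset.sum_add_distrib]
  refine Finset.sum_le_sum fun s _ => ?_
  rw [Finset.offDiag_card]
  unfold parity
  set k := (F.filter fun e => Hit B j s (edgeKey e)).card
  rcases Nat.lt_or_ge k 2 with hk | hk
  · interval_cases k <;> simp
  · have := Nat.mul_le_mul_right k hk
    omega

theorem oddSeeds_few {n : ℕ} {B j : ℕ} (hj : j ≤ B) {F : Finset (Sym2 (Fin n))}
    (hF : 1024 * F.card ≤ 2 ^ j) : 1024 * oddSeeds B j F ≤ 2 ^ B * 2 ^ B := by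
  have h : (2 : ℕ) ^ B = 2 ^ (B - j) * 2 ^ j := by rw [← pow_add, Nat.sub_add_cancel hj]
  calc 1024 * oddSeeds B j F ≤ 1024 * (F.card * (2 ^ B * 2 ^ (B - j))) :=
        Nat.mul_le_mul_left _ (oddSeeds_le hj F)
    _ = 2 ^ B * (2 ^ (B - j) * (1024 * F.card)) := by ring
    _ ≤ 2 ^ B * (2 ^ (B - j) * 2 ^ j) := by gcongr
    _ = _ := by rw [← h]

/-- Put `p = F.card / 2 ^ j`, which lies between `1/16` and `1/8`. The odd seeds have density at
least `p - 4 * p ^ 2 ≥ p / 2 ≥ 1/32`. -/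
theorem oddSeeds_many {n : ℕ} {B j : ℕ} (hj : j ≤ B) (hn : n * n ≤ 2 ^ (B - j))
    {F : Finset (Sym2 (Fin n))} (h1 : 8 * F.card ≤ 2 ^ j) (h2 : 2 ^ j ≤ 16 * F.card) :
    2 ^ B * 2 ^ B ≤ 32 * oddSeeds B j F := by
  have h : (2 : ℕ) ^ B = 2 ^ (B - j) * 2 ^ j := by rw [← pow_add, Nat.sub_add_cancel hj]
  have h3 := le_oddSeeds_add hj hn F
  set W := 2 ^ (B - j)
  set M := 2 ^ B
  set X := F.card
  have h4 : 8 * (X * X * (4 * (W * W))) ≤ 4 * (X * (M * W)) := by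
    calc 8 * (X * X * (4 * (W * W))) = 4 * (X * ((W * (8 * X)) * W)) := by ring
      _ ≤ 4 * (X * ((W * 2 ^ j) * W)) := by gcongr
      _ = _ := by rw [← h]
  have h5 : M * M ≤ 16 * (X * (M * W)) := by
    calc M * M = M * (W * 2 ^ j) := by rw [← h]
      _ ≤ M * (W * (16 * X)) := by gcongr
      _ = _ := by ring
  omega

/-! ## Random seeds -/

instance : IsProbabilityMeasure coinTosses := by
  unfold coinTosses
  infer_instance

theorem measurable_bitsVal (a k : ℕ) : Measurable fun ω : ℕ → Bool => bitsVal ω a k := by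
  induction k with
  | zero => exact measurable_const
  | succ k ih =>
    have h : Measurable fun ω : ℕ → Bool => (ω (a + k)).toNat :=
      (measurable_from_top (f := Bool.toNat)).comp (measurable_pi_apply _)
    exact (measurable_const.mul ih).add h

theorem dependsOn_bitsVal (a k : ℕ) :
    DependsOn (fun ω : ℕ → Bool => bitsVal ω a k) (Finset.Ico a (a + k)) := by
  intro ω ω' h
  simp only [Finset.coe_Ico, Set.mem_Ico] at h
  induction k with
  | zero => rfl
  | succ k ih =>
    have h1 := ih fun i hi => h i ⟨hi.1, by omega⟩
    simp only at h1
    simp only [bitsVal, h1, h (a + k) ⟨by omega, by omega⟩]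

theorem lintegral_mul_of_dependsOn {S T : Finset ℕ} (hST : Disjoint S T)
    {f g : (ℕ → Bool) → ENNReal} (hf : Measurable f) (hg : Measurable g)
    (hfS : DependsOn f S) (hgT : DependsOn g T) :
    ∫⁻ ω, f ω * g ω ∂coinTosses = (∫⁻ ω, f ω ∂coinTosses) * ∫⁻ ω, g ω ∂coinTosses := by
  have hind : ProbabilityTheory.iIndepFun (fun (i : ℕ) (ω : ℕ → Bool) => ω i) coinTosses :=
    ProbabilityTheory.iIndepFun_infinitePi (X := fun _ x => x) fun _ => measurable_id
  have hfin := hind.indepFun_finset S T hST fun i => measurable_pi_apply i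
  -- Padding with `false` turns a function that depends only on the coins in `U` into a function of
  -- their restriction to `U`, to which independence of disjoint blocks applies.
  let ext (U : Finset ℕ) (x : U → Bool) (j : ℕ) : Bool := if h : j ∈ U then x ⟨j, h⟩ else false
  have hext : ∀ U, Measurable (ext U) := fun U => by
    refine measurable_pi_lambda _ fun j => ?_
    by_cases h : j ∈ U
    · simpa [ext, h] using measurable_pi_apply (⟨j, h⟩ : U)
    · simp [ext, h]
  have hcomp := hfin.comp (hf.comp (hext S)) (hg.comp (hext T))
  have e1 : (f ∘ ext S) ∘ (fun ω (i : S) => ω i) = f := by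
    funext ω
    exact hfS fun i hi => by simp [ext, Finset.mem_coe.1 hi]
  have e2 : (g ∘ ext T) ∘ (fun ω (i : T) => ω i) = g := by
    funext ω
    exact hgT fun i hi => by simp [ext, Finset.mem_coe.1 hi]
  rw [e1, e2] at hcomp
  exact ProbabilityTheory.lintegral_mul_eq_lintegral_mul_lintegral_of_indepFun hf hg hcomp

theorem lintegral_coin (i : ℕ) (h : Bool → ENNReal) :
    2 * ∫⁻ ω, h (ω i) ∂coinTosses = h false + h true := by
  have h1 : ∫⁻ ω, h (ω i) ∂coinTosses =
      ∫⁻ b, h b ∂(PMF.uniformOfFintype Bool).toMeasure := by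
    have := Measure.infinitePi_map_eval
      (fun _ : ℕ => (PMF.uniformOfFintype Bool).toMeasure) i
    rw [← this, lintegral_map measurable_from_top (measurable_pi_apply i)]
    rfl
  rw [h1, lintegral_fintype, Fintype.sum_bool]
  simp only [PMF.toMeasure_apply_singleton _ _ (measurableSet_singleton _),
    PMF.uniformOfFintype_apply, Fintype.card_bool, Nat.cast_ofNat]
  rw [← add_mul, mul_comm, mul_assoc, ENNReal.inv_mul_cancel two_ne_zero ENNReal.ofNat_ne_top,
    mul_one, add_comm]

theorem sum_range_two_mul (m : ℕ) (g : ℕ → ENNReal) :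
    ∑ s ∈ Finset.range (2 * m), g s = ∑ s ∈ Finset.range m, (g (2 * s) + g (2 * s + 1)) := by
  induction m with
  | zero => simp
  | succ m ih => rw [mul_add, mul_one, Finset.sum_range_succ, Finset.sum_range_succ, ih,
      Finset.sum_range_succ, add_assoc]

/-- The digits give a uniform number below `2 ^ k`. The factor `2 ^ k` stands on the left to avoid
division in `ENNReal`; the induction splits off the last coin, which is independent of the earlier
ones. -/
theorem lintegral_bitsVal (a k : ℕ) : ∀ g : ℕ → ENNReal,
    2 ^ k * ∫⁻ ω, g (bitsVal ω a k) ∂coinTosses = ∑ s ∈ Finset.range (2 ^ k), g s := by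
  induction k with
  | zero => simp [bitsVal]
  | succ k ih =>
    intro g
    have hsplit : ∀ ω : ℕ → Bool, g (bitsVal ω a (k + 1)) =
        g (2 * bitsVal ω a k) * (if ω (a + k) then 0 else 1) +
          g (2 * bitsVal ω a k + 1) * (if ω (a + k) then 1 else 0) := by
      intro ω
      cases h : ω (a + k) <;> simp [bitsVal, h]
    have hmb := measurable_bitsVal a k
    have hm : ∀ G : ℕ → ENNReal, Measurable fun ω => G (bitsVal ω a k) := fun G =>
      (measurable_from_top (f := G)).comp hmb
    have hm' : ∀ G : Bool → ENNReal, Measurable fun ω : ℕ → Bool => G (ω (a + k)) := fun G =>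
      (measurable_from_top (f := G)).comp (measurable_pi_apply _)
    have hprod : ∀ (G : ℕ → ENNReal) (G' : Bool → ENNReal),
        2 ^ (k + 1) * ∫⁻ ω, G (bitsVal ω a k) * G' (ω (a + k)) ∂coinTosses =
          (∑ s ∈ Finset.range (2 ^ k), G s) * (G' false + G' true) := fun G G' => by
      rw [lintegral_mul_of_dependsOn (S := Finset.Ico a (a + k)) (T := {a + k}) (by simp)
        (hm G) (hm' G') (fun ω ω' h => congrArg G (dependsOn_bitsVal a k h))
        (fun ω ω' h => congrArg G' (h _ (by simp))), ← ih, ← lintegral_coin (a + k), pow_succ]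
      ring
    have hadd : ∫⁻ ω, g (bitsVal ω a (k + 1)) ∂coinTosses =
        ∫⁻ ω, g (2 * bitsVal ω a k) * (if ω (a + k) then 0 else 1) ∂coinTosses +
          ∫⁻ ω, g (2 * bitsVal ω a k + 1) * (if ω (a + k) then 1 else 0) ∂coinTosses := by
      simp only [hsplit]
      exact lintegral_add_left ((hm fun s => g (2 * s)).mul (hm' fun b => if b then 0 else 1)) _
    have p1 := hprod (fun s => g (2 * s)) (fun b => if b then 0 else 1)
    have p2 := hprod (fun s => g (2 * s + 1)) (fun b => if b then 1 else 0)
    beta_reduce at p1 p2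
    rw [hadd, mul_add, p1, p2, pow_succ', sum_range_two_mul, Finset.sum_add_distrib]
    simp

theorem lintegral_prod_bitsVal (a Q : ℕ) (g : ℕ → ENNReal) (m : ℕ) :
    (2 ^ Q) ^ m * ∫⁻ ω, ∏ i ∈ Finset.range m, g (bitsVal ω (a + i * Q) Q) ∂coinTosses =
      (∑ s ∈ Finset.range (2 ^ Q), g s) ^ m := by
  have hm : ∀ i, Measurable fun ω => g (bitsVal ω (a + i * Q) Q) := fun i =>
    (measurable_from_top (f := g)).comp (measurable_bitsVal _ _)
  induction m with
  | zero => simp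
  | succ m ih =>
    simp only [Finset.prod_range_succ]
    rw [lintegral_mul_of_dependsOn (S := Finset.Ico a (a + m * Q))
      (T := Finset.Ico (a + m * Q) (a + m * Q + Q)) (Finset.Ico_disjoint_Ico_consecutive _ _ _)
      (Finset.measurable_fun_prod _ fun i _ => hm i) (hm m) ?_
      (fun ω ω' h => congrArg g (dependsOn_bitsVal _ _ h)), pow_succ, pow_succ, ← ih,
      ← lintegral_bitsVal (a + m * Q) Q g]
    · ring
    · intro ω ω' h
      refine Finset.prod_congr rfl fun i hi => congrArg g (dependsOn_bitsVal _ _ fun l hl => ?_)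
      refine h l ?_
      have := Nat.mul_le_mul_right Q (Nat.succ_le_of_lt (Finset.mem_range.1 hi))
      rw [Nat.succ_mul] at this
      simp only [Finset.coe_Ico, Set.mem_Ico] at hl ⊢
      omega

/-- A Chernoff bound for `128 * m` independent seeds. -/
theorem coinTosses_le_of_prod {a Q m p q K : ℕ} (hq : 0 < q) (g : ℕ → ℕ)
    (hg : q * ∑ s ∈ Finset.range (2 ^ Q), g s ≤ p * 2 ^ Q) (hpq : 2 * p ^ 128 ≤ K * q ^ 128)
    (hK : 0 < K) {A : Set (ℕ → Bool)}
    (hA : ∀ ω ∈ A, K ^ m ≤ ∏ i ∈ Finset.range (128 * m), g (bitsVal ω (a + i * Q) Q)) :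
    2 ^ m * coinTosses A ≤ 1 := by
  set r := 128 * m with hr
  have h1 := lintegral_prod_bitsVal a Q (fun s => (g s : ENNReal)) r
  set E := ∫⁻ ω, ∏ i ∈ Finset.range r, (g (bitsVal ω (a + i * Q) Q) : ENNReal) ∂coinTosses
  -- Markov's inequality for the product. Each factor has mean at most `p / q`, so `E ≤ (p / q) ^
  -- (128 * m) ≤ (K / 2) ^ m`.
  have h2 : (K ^ m : ENNReal) * coinTosses A ≤ E := by
    refine le_trans ?_ (mul_meas_ge_le_lintegral₀ (Finset.measurable_fun_prod _ fun i _ =>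
      (measurable_from_top (f := fun s => (g s : ENNReal))).comp
        (measurable_bitsVal _ _)).aemeasurable ((K : ENNReal) ^ m))
    gcongr
    intro ω hω
    have h := hA ω hω
    simp only [Set.mem_ofPred_eq, Function.comp]
    exact_mod_cast h
  have h3 : (q ^ r * (∑ s ∈ Finset.range (2 ^ Q), (g s : ENNReal)) ^ r : ENNReal) ≤ p ^ r * (2 ^ Q) ^ r := by
    have := Nat.pow_le_pow_left hg r
    rw [mul_pow, mul_pow] at this
    exact_mod_cast this
  have h4 : (2 ^ m * p ^ r : ENNReal) ≤ K ^ m * q ^ r := by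
    have := Nat.pow_le_pow_left hpq m
    rw [mul_pow, mul_pow, ← pow_mul, ← pow_mul] at this
    exact_mod_cast this
  -- The common denominator; it is nonzero and finite, hence can be cancelled.
  set D : ENNReal := (q ^ r * (2 ^ Q) ^ r) * K ^ m with hD
  have hD0 : D ≠ 0 := by
    have : D = ((q ^ r * (2 ^ Q) ^ r * K ^ m : ℕ) : ENNReal) := by push_cast; rfl
    rw [this, Nat.cast_ne_zero]
    positivity
  have hDt : D ≠ ⊤ := by
    have : D = ((q ^ r * (2 ^ Q) ^ r * K ^ m : ℕ) : ENNReal) := by push_cast; rfl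
    rw [this]
    exact ENNReal.natCast_ne_top _
  refine (ENNReal.mul_le_mul_iff_right hD0 hDt).1 ?_
  calc D * (2 ^ m * coinTosses A)
      = 2 ^ m * q ^ r * ((2 ^ Q) ^ r * (K ^ m * coinTosses A)) := by rw [hD]; ring
    _ ≤ 2 ^ m * q ^ r * ((2 ^ Q) ^ r * E) := by gcongr
    _ = 2 ^ m * (q ^ r * (∑ s ∈ Finset.range (2 ^ Q), (g s : ENNReal)) ^ r) := by rw [h1]; ring
    _ ≤ 2 ^ m * (p ^ r * (2 ^ Q) ^ r) := mul_le_mul' le_rfl h3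
    _ = (2 ^ m * p ^ r) * (2 ^ Q) ^ r := by ring
    _ ≤ (K ^ m * q ^ r) * (2 ^ Q) ^ r := by gcongr
    _ = D * 1 := by rw [hD]; ring

/-! ### Concentration of the number of odd samples -/

/-- The number of samples on level `j` that contain an odd number of elements of `F`. -/
def oddSamples {n : ℕ} (R : ℕ) (ω : ℕ → Bool) (F : Finset (Sym2 (Fin n))) (j : ℕ) : ℕ :=
  ∑ i ∈ Finset.range (cols R n), parity (logM n) j (seed n ω (j * cols R n + i)) F

theorem parity_eq_zero_or_one {n : ℕ} (B j a : ℕ) (F : Finset (Sym2 (Fin n))) :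
    parity B j a F = 0 ∨ parity B j a F = 1 := Nat.mod_two_eq_zero_or_one _

theorem seed_add (n j r i : ℕ) (ω : ℕ → Bool) : seed n ω (j * r + i) =
    bitsVal ω (j * r * (2 * logM n) + i * (2 * logM n)) (2 * logM n) := by
  rw [seed, add_mul]

theorem two_pow_two_mul (B : ℕ) : (2 : ℕ) ^ (2 * B) = 2 ^ B * 2 ^ B := by rw [two_mul, pow_add]

/-- An odd sample gets weight 8 and an even one weight 1, so the mean is at most `1 + 7/1024 ≤
129/128`. The constants fit because `2 * (129/128) ^ 128`, about `2 * e`, is below 8. -/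
theorem coinTosses_quorum_le_oddSamples {n R j : ℕ} (hj : j ≤ logM n)
    {F : Finset (Sym2 (Fin n))} (hF : 1024 * F.card ≤ 2 ^ j) :
    2 ^ quorum R n * coinTosses {ω | quorum R n ≤ oddSamples R ω F j} ≤ 1 := by
  refine coinTosses_le_of_prod (a := j * cols R n * (2 * logM n)) (Q := 2 * logM n) (q := 128)
    (p := 129) (K := 8) (by norm_num) (fun s => 8 ^ parity (logM n) j s F) ?_ (by norm_num)
    (by norm_num) fun ω hω => ?_
  · have h1 := oddSeeds_few hj hF
    rw [two_pow_two_mul]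
    have h2 : ∑ s ∈ Finset.range (2 ^ logM n * 2 ^ logM n), 8 ^ parity (logM n) j s F =
        2 ^ logM n * 2 ^ logM n + 7 * oddSeeds (logM n) j F := by
      rw [oddSeeds, Finset.card_filter, Finset.mul_sum]
      nth_rw 2 [← Finset.card_range (2 ^ logM n * 2 ^ logM n)]
      rw [Finset.card_eq_sum_ones, ← Finset.sum_add_distrib]
      refine Finset.sum_congr rfl fun s _ => ?_
      rcases parity_eq_zero_or_one (logM n) j s F with h | h <;> simp [h]
    rw [h2]
    omega
  · rw [Finset.prod_pow_eq_pow_sum]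
    simp only [← seed_add]
    exact Nat.pow_le_pow_right (by norm_num) hω

/-- Now even samples get weight 2 and odd ones weight 1, with mean at most `2 - 1/32 = 63/32`. Fewer
than `m` odd samples among `128 * m` leave more than `127 * m` even ones, whence `K = 2 ^ 127`. -/
theorem coinTosses_oddSamples_lt_quorum {n R j : ℕ} (hj : j ≤ logM n)
    (hn : n * n ≤ 2 ^ (logM n - j)) {F : Finset (Sym2 (Fin n))} (h1 : 8 * F.card ≤ 2 ^ j)
    (h2 : 2 ^ j ≤ 16 * F.card) :
    2 ^ quorum R n * coinTosses {ω | oddSamples R ω F j < quorum R n} ≤ 1 := by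
  refine coinTosses_le_of_prod (a := j * cols R n * (2 * logM n)) (Q := 2 * logM n) (q := 32)
    (p := 63) (K := 2 ^ 127) (by norm_num) (fun s => 2 ^ (1 - parity (logM n) j s F)) ?_
    (by norm_num) (by norm_num) fun ω hω => ?_
  · have h3 := oddSeeds_many hj hn h1 h2
    rw [two_pow_two_mul]
    have h4 : ∑ s ∈ Finset.range (2 ^ logM n * 2 ^ logM n), 2 ^ (1 - parity (logM n) j s F) +
        oddSeeds (logM n) j F = 2 * (2 ^ logM n * 2 ^ logM n) := by
      have h5 : ∑ s ∈ Finset.range (2 ^ logM n * 2 ^ logM n), 2 =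
          2 * (2 ^ logM n * 2 ^ logM n) := by simp [mul_comm]
      rw [oddSeeds, Finset.card_filter, ← Finset.sum_add_distrib, ← h5]
      refine Finset.sum_congr rfl fun s _ => ?_
      rcases parity_eq_zero_or_one (logM n) j s F with h | h <;> simp [h]
    omega
  · rw [Finset.prod_pow_eq_pow_sum, ← pow_mul]
    simp only [← seed_add]
    refine Nat.pow_le_pow_right (by norm_num) ?_
    have h5 : ∑ i ∈ Finset.range (128 * quorum R n),
        (1 - parity (logM n) j (seed n ω (j * cols R n + i)) F) + oddSamples R ω F j =
          128 * quorum R n := by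
      rw [oddSamples, cols, ← Finset.sum_add_distrib]
      trans ∑ _i ∈ Finset.range (128 * quorum R n), 1
      swap
      · simp
      refine Finset.sum_congr rfl fun i _ => ?_
      rcases parity_eq_zero_or_one (logM n) j (seed n ω (j * (128 * quorum R n) + i)) F with h | h
        <;> simp [h]
    have h6 : oddSamples R ω F j < quorum R n := hω
    omega

/-! ## Correctness -/

theorem oddCount_sketch {n R : ℕ} {ω : ℕ → Bool} {f : ℕ → ℕ} {G : LabeledGraph (Fin n)}
    {H : Sym2 (Fin n) → Option Label}
    (hH : ∀ e : (⊤ : SimpleGraph (Fin n)).edgeSet, H e = some (G e)) (j : ℕ) :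
    oddCount R n (seed n ω) (sketch R (seed n ω) H) f j =
      oddSamples R ω (disagreements G (Setoid.ker fun v : Fin n => f v)) j := by
  refine Finset.sum_congr rfl fun i hi => ?_
  have hi := Finset.mem_range.1 hi
  rw [oddBit_sketch hH]
  have : (j * cols R n + i) / cols R n = j := by
    rw [mul_comm, Nat.mul_add_div (by omega), Nat.div_eq_of_lt hi, add_zero]
  rw [this]

/-- The clustering of number `x`. -/
def clustering (n x : ℕ) : Setoid (Fin n) := Setoid.ker fun v : Fin n => digit n x v

/-- The score of the clustering `C` for the coin tosses `ω`. -/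
noncomputable def scoreOf {n : ℕ} (R : ℕ) (ω : ℕ → Bool) (G : LabeledGraph (Fin n))
    (C : Setoid (Fin n)) : ℕ :=
  lastLevel (quorum R n) (oddSamples R ω (disagreements G C)) (logM n)

theorem exists_outputs {n : ℕ} (hn : 0 < n) (R : ℕ) {G : LabeledGraph (Fin n)}
    {σ : List (StreamItem (Fin n))} (hσ : IsDynamicStream σ G) (ω : ℕ → Bool) :
    ∃ x < n ^ n, (clusterAlg R).Outputs (algSpace R n) σ ω (clustering n x) ∧
      ∀ y < n ^ n, scoreOf R ω G (clustering n x) ≤ scoreOf R ω G (clustering n y) := by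
  obtain ⟨c₀, h0, h0'⟩ := ok_startProg R n ω
  obtain ⟨c₁, H, h1, h1', hH⟩ := exists_reads σ _ c₀ hσ
    (h0'.congr (fun _ _ => rfl) (fun i _ => (sketch_empty R _ i).symm) fun _ _ => rfl)
  obtain ⟨c₂, h2, x, hx, hname, hmin⟩ := ok_finishProg hn h1'
  have hscore : ∀ y, score R n (seed n ω) (sketch R (seed n ω) H) (digit n y) =
      scoreOf R ω G (clustering n y) := fun y => by
    rw [score, scoreOf, clustering]
    congr 1
    funext j
    exact oddCount_sketch hH j
  simp only [hscore] at hmin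
  refine ⟨x, hx, ⟨c₀, c₁, c₂, bits_le_algSpace (fits_init R n), h0, h1, h2, ?_⟩, hmin⟩
  rw [clustering]
  congr 1
  funext v
  exact (hname v v.isLt).symm

/-- Naming each vertex after a representative of its cluster uses only names below `n`, so the
search meets every clustering, in particular an optimal one. -/
theorem exists_clustering_eq {n : ℕ} (C : Setoid (Fin n)) :
    ∃ x < n ^ n, clustering n x = C := by
  set f : Fin n → Fin n := fun v => (Quotient.mk C v).out with hf
  refine ⟨finFunctionFinEquiv f, (finFunctionFinEquiv f).isLt, ?_⟩
  have h : ∀ v : Fin n, digit n (finFunctionFinEquiv f) v = f v := fun v => by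
    have := congrFun (finFunctionFinEquiv.symm_apply_apply f) v
    exact congrArg Fin.val this
  ext u v
  change digit n _ u = digit n _ v ↔ _
  rw [h, h, Fin.val_inj]
  exact Quotient.out_inj.trans Quotient.eq

theorem card_edges_le {n : ℕ} (F : Finset (Sym2 (Fin n))) : F.card ≤ n * n := by
  rw [← Finset.card_range (n * n)]
  exact Finset.card_le_card_of_injOn edgeKey
    (fun e _ => by simpa using edgeKey_lt e) (edgeKey_injective n).injOn

/-- Rounding `8 * X` up to a power of two at most doubles it. As `X ≤ n ^ 2`, this power is at most
`16 * n ^ 2`, and `16 * n ^ 4 ≤ 2 ^ logM n` leaves the required window; `n ≥ 2` makes the level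
strictly smaller than `logM n`. -/
theorem exists_level {n X : ℕ} (hn : 2 ≤ n) (hX : 0 < X) (hXn : X ≤ n * n) :
    ∃ j < logM n, n * n ≤ 2 ^ (logM n - j) ∧ 8 * X ≤ 2 ^ j ∧ 2 ^ j ≤ 16 * X := by
  refine ⟨Nat.clog 2 (8 * X), ?_⟩
  have h1 : 8 * X ≤ 2 ^ Nat.clog 2 (8 * X) := Nat.le_pow_clog one_lt_two _
  have h2 : 2 ^ Nat.clog 2 (8 * X) ≤ 16 * X := by
    have h3 : Nat.clog 2 (8 * X) ≠ 0 := fun h => by rw [h] at h1; omega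
    obtain ⟨k, hk⟩ := Nat.exists_eq_succ_of_ne_zero h3
    have h4 := Nat.pow_lt_of_lt_clog (show k < Nat.clog 2 (8 * X) by omega)
    rw [hk, pow_succ]
    omega
  set j := Nat.clog 2 (8 * X)
  have h3 := le_two_pow_logM n
  have h4 : n * n < n ^ 4 := by
    have : 2 * 2 ≤ n * n := Nat.mul_le_mul hn hn
    calc n * n < (n * n) * (n * n) := by nlinarith
      _ = n ^ 4 := by ring
  have hj : j < logM n := by
    rw [← Nat.pow_lt_pow_iff_right one_lt_two]
    omega
  refine ⟨hj, ?_, h1, h2⟩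
  have h5 : (2 : ℕ) ^ logM n = 2 ^ (logM n - j) * 2 ^ j := by
    rw [← pow_add, Nat.sub_add_cancel hj.le]
  refine Nat.le_of_mul_le_mul_right ?_ (Nat.two_pow_pos j)
  rw [← h5]
  calc n * n * 2 ^ j ≤ n * n * (16 * (n * n)) := by gcongr; omega
    _ = 16 * n ^ 4 := by ring
    _ ≤ _ := h3

/-- If the scores are accurate enough, a clustering with the least score is a
`128`-approximation. -/
theorem clusterCost_le {n R : ℕ} {ω : ℕ → Bool} {G : LabeledGraph (Fin n)}
    {C C' : Setoid (Fin n)} (hle : scoreOf R ω G C ≤ scoreOf R ω G C')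
    (hC' : ∀ j < logM n, 1024 * clusterCost G C' ≤ 2 ^ j →
      oddSamples R ω (disagreements G C') j < quorum R n)
    (hC : 0 < clusterCost G C → ∃ j < logM n, 8 * clusterCost G C ≤ 2 ^ j ∧
      quorum R n ≤ oddSamples R ω (disagreements G C) j) :
    clusterCost G C ≤ 128 * clusterCost G C' := by
  rcases Nat.eq_zero_or_pos (clusterCost G C) with h | h
  · omega
  obtain ⟨j, hj, h1, h2⟩ := hC h
  have h3 : j + 1 ≤ scoreOf R ω G C := le_lastLevel hj h2
  obtain ⟨j', hj', h4, h5⟩ := exists_of_lastLevel_pos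
    (show lastLevel (quorum R n) (oddSamples R ω (disagreements G C')) (logM n) ≠ 0 from
      (show 0 < scoreOf R ω G C' by omega).ne')
  have h6 : scoreOf R ω G C' = j' + 1 := h4
  have h7 : 2 ^ j' < 1024 * clusterCost G C' := by
    by_contra h
    exact absurd h5 (not_le.2 (hC' j' hj' (not_lt.1 h)))
  -- The comparison of scores gives `j ≤ j'`, so the cost of `C` times 8 is at most `2 ^ j ≤ 2 ^
  -- j'`, which is below 1024 times the cost of `C'`.
  have h8 : 2 ^ j ≤ 2 ^ j' := Nat.pow_le_pow_right two_pos (by omega)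
  omega

theorem ENNReal.le_inv_of_mul_le_one {a b : ENNReal} (h : a * b ≤ 1) : b ≤ a⁻¹ := by
  rw [ENNReal.le_inv_iff_mul_le, mul_comm]
  exact h

theorem one_le_logM {n : ℕ} (hn : 1 ≤ n) : 1 ≤ logM n := by
  by_contra h
  have h1 := le_two_pow_logM n
  obtain h2 : logM n = 0 := by omega
  rw [h2] at h1
  have := Nat.one_le_pow 4 n hn
  omega

/-- In units of `n * logM n`, the exponent must cover one unit for `n ^ n` and for `logM n`, one for
the factor 2 of their sum, and `c` for `n ^ c`; `R = c + 3` suffices. -/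
theorem quorum_large {n c : ℕ} (hn : 1 ≤ n) :
    (logM n + n ^ n) * n ^ c ≤ 2 ^ quorum (c + 3) n := by
  have hB := one_le_logM hn
  have h1 : logM n ≤ 2 ^ (n * logM n) := Nat.lt_two_pow_self.le.trans
    (Nat.pow_le_pow_right two_pos (Nat.le_mul_of_pos_left _ hn))
  have h2 : n ^ n ≤ 2 ^ (n * logM n) := by
    rw [mul_comm, pow_mul]
    exact Nat.pow_le_pow_left (lt_two_pow_logM n).le _
  have h3 : n ^ c ≤ 2 ^ (c * (n * logM n)) := by
    calc n ^ c ≤ (2 ^ logM n) ^ c := Nat.pow_le_pow_left (lt_two_pow_logM n).le _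
      _ = 2 ^ (c * logM n) := by rw [← pow_mul, mul_comm]
      _ ≤ _ := Nat.pow_le_pow_right two_pos
        (Nat.mul_le_mul_left _ (Nat.le_mul_of_pos_left _ hn))
  calc (logM n + n ^ n) * n ^ c
      ≤ (2 ^ (n * logM n) + 2 ^ (n * logM n)) * 2 ^ (c * (n * logM n)) := by gcongr
    _ = 2 ^ (n * logM n + 1 + c * (n * logM n)) := by rw [← two_mul, ← pow_succ', ← pow_add]
    _ ≤ 2 ^ quorum (c + 3) n := Nat.pow_le_pow_right two_pos (by
        have : 1 ≤ n * logM n := Nat.mul_pos hn hB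
        unfold quorum
        nlinarith)

/-- The union bound is asymmetric. A score that is too high does harm only for one fixed optimal
clustering `C₀`, whereas a score that is too low must be excluded for all `n ^ n` candidates, each
on a single level chosen before the coins are tossed. Monotonicity and subadditivity suffice, so the
failure set need not be measurable. -/
theorem coinTosses_failure_le {n c : ℕ} (hn : 2 ≤ n) {G : LabeledGraph (Fin n)}
    {σ : List (StreamItem (Fin n))} (hσ : IsDynamicStream σ G) :
    coinTosses {ω | ¬ ∃ C : Setoid (Fin n),
      (clusterAlg (c + 3)).Outputs (algSpace (c + 3) n) σ ω C ∧ IsApproxClustering 128 G C} ≤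
        ENNReal.ofReal (1 / (n : ℝ) ^ c) := by
  classical
  set R := c + 3
  set q := quorum R n
  set C₀ := Function.argmin (clusterCost G) with hC₀
  have hmin : ∀ C, clusterCost G C₀ ≤ clusterCost G C := fun C => Function.argmin_le _ _
  have hlev : ∀ C : Setoid (Fin n), ∃ j, 0 < clusterCost G C → j < logM n ∧
      n * n ≤ 2 ^ (logM n - j) ∧ 8 * clusterCost G C ≤ 2 ^ j ∧ 2 ^ j ≤ 16 * clusterCost G C := by
    intro C
    by_cases h : 0 < clusterCost G C
    · obtain ⟨j, hj⟩ := exists_level hn h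
        (by rw [← card_disagreements]; exact card_edges_le _)
      exact ⟨j, fun _ => hj⟩
    · exact ⟨0, fun h' => absurd h' h⟩
  choose lev hlev using hlev
  -- `U`: the optimal clustering reaches the quorum on a level that is far too high. `L` below: some
  -- candidate of positive cost misses the quorum on its own level.
  let U : Set (ℕ → Bool) := ⋃ j ∈ (Finset.range (logM n)).filter
    fun j => 1024 * clusterCost G C₀ ≤ 2 ^ j, {ω | q ≤ oddSamples R ω (disagreements G C₀) j}
  let L : Set (ℕ → Bool) := ⋃ x ∈ (Finset.range (n ^ n)).filter
    fun x => 0 < clusterCost G (clustering n x), {ω | oddSamples R ω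
      (disagreements G (clustering n x)) (lev (clustering n x)) < q}
  have hsub : {ω | ¬ ∃ C : Setoid (Fin n), (clusterAlg R).Outputs (algSpace R n) σ ω C ∧
      IsApproxClustering 128 G C} ⊆ U ∪ L := by
    intro ω hω
    by_contra hbad
    simp only [U, L, Set.mem_union, Set.mem_iUnion, Finset.mem_filter, Finset.mem_range,
      Set.mem_ofPred_eq, not_or, not_exists] at hbad
    refine hω ?_
    obtain ⟨x, hx, hout, hscore⟩ := exists_outputs (by omega) R hσ ω
    refine ⟨_, hout, fun C' => ?_⟩
    obtain ⟨y, hy, hyC⟩ := exists_clustering_eq C₀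
    have h1 := clusterCost_le (hyC ▸ hscore y hy)
      (fun j hj h => not_le.1 (hbad.1 j ⟨hj, h⟩))
      (fun h => ⟨lev (clustering n x), (hlev _ h).1, (hlev _ h).2.2.1,
        not_lt.1 (hbad.2 x ⟨hx, h⟩)⟩)
    have h2 := Nat.mul_le_mul_left 128 (hmin C')
    exact_mod_cast h1.trans h2
  have hU : coinTosses U ≤ logM n * (2 ^ q)⁻¹ := by
    refine (measure_biUnion_finset_le _ _).trans ?_
    refine (Finset.sum_le_card_nsmul _ _ ((2 ^ q)⁻¹ : ENNReal) fun j hj => ?_).trans ?_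
    · obtain ⟨hj, h⟩ := Finset.mem_filter.1 hj
      exact ENNReal.le_inv_of_mul_le_one (coinTosses_quorum_le_oddSamples (Finset.mem_range.1 hj).le
        (by rwa [card_disagreements]))
    · rw [nsmul_eq_mul]
      gcongr
      simpa using Finset.card_filter_le (Finset.range (logM n)) _
  have hL : coinTosses L ≤ (n ^ n : ℕ) * (2 ^ q)⁻¹ := by
    refine (measure_biUnion_finset_le _ _).trans ?_
    refine (Finset.sum_le_card_nsmul _ _ ((2 ^ q)⁻¹ : ENNReal) fun x hx => ?_).trans ?_
    · obtain ⟨-, h⟩ := Finset.mem_filter.1 hx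
      obtain ⟨h1, h2, h3, h4⟩ := hlev _ h
      exact ENNReal.le_inv_of_mul_le_one (coinTosses_oddSamples_lt_quorum h1.le h2
        (by rwa [card_disagreements]) (by rwa [card_disagreements]))
    · rw [nsmul_eq_mul]
      gcongr
      simpa using Finset.card_filter_le (Finset.range (n ^ n)) _
  have hn0 : (0 : ℝ) < (n : ℝ) ^ c := by positivity
  rw [one_div, ENNReal.ofReal_inv_of_pos hn0, ENNReal.ofReal_pow (by positivity),
    ENNReal.ofReal_natCast]
  refine (measure_mono hsub).trans ((measure_union_le _ _).trans ((add_le_add hU hL).trans ?_))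
  refine ENNReal.le_inv_of_mul_le_one ?_
  have h := quorum_large (n := n) (c := c) (by omega)
  have h' : ((logM n + (n ^ n : ℕ)) * n ^ c : ENNReal) ≤ 2 ^ q := by exact_mod_cast h
  calc ((n : ENNReal) ^ c * (logM n * (2 ^ q)⁻¹ + (n ^ n : ℕ) * (2 ^ q)⁻¹))
      = ((logM n + (n ^ n : ℕ)) * n ^ c) * (2 ^ q)⁻¹ := by ring
    _ ≤ 2 ^ q * (2 ^ q)⁻¹ := by gcongr
    _ ≤ 1 := ENNReal.mul_inv_le_one _

/-! ## The space bound -/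

/-- The dominant terms come from the seeds and the sketch: `128 * R * n * B ^ 2` cells each, whose
indices already take `O(B)` bits, so even one-bit entries cost `O(B)`. -/
theorem algSpace_le {R n : ℕ} (hn : 1 ≤ n) :
    algSpace R n ≤ (310 + 17 * R + 128 * R * (23 + 2 * R)) * (n * logM n ^ 3) := by
  have hB := one_le_logM hn
  have h1 : Nat.size n ≤ logM n := Nat.size_le.2 (lt_two_pow_logM n)
  have h2 : Nat.size (logM n) ≤ logM n := Nat.size_le.2 Nat.lt_two_pow_self
  have h3 : Nat.size (cells R n) ≤ 7 + R + 3 * logM n := by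
    refine (Nat.size_le.2 (cells_lt R n)).trans (le_of_eq ?_)
    ring
  have h4 : Nat.size 17 ≤ 5 := Nat.size_le.2 (by norm_num)
  have hc : cells R n = 128 * R * (n * logM n ^ 2) := by
    unfold cells cols quorum
    ring
  have e : algSpace R n = 17 * (Nat.size 17 + varBits R n) + n * (Nat.size n + logM n) +
      cells R n * (Nat.size (cells R n) + 2 * logM n) + cells R n * (Nat.size (cells R n) + 1) +
      logM n * (Nat.size (logM n) + logM n) := by
    simp [algSpace, space, Finset.sum_range_succ, width, depth]
  set B := logM n
  have p0 : 1 ≤ n * B ^ 3 := Nat.mul_pos hn (Nat.pow_pos hB)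
  have p1 : B ≤ n * B ^ 3 := by
    calc B = 1 * B ^ 1 := by ring
      _ ≤ n * B ^ 3 := Nat.mul_le_mul hn (Nat.pow_le_pow_right hB (by norm_num))
  have p2 : n * B ≤ n * B ^ 3 := by
    calc n * B = n * B ^ 1 := by ring
      _ ≤ n * B ^ 3 := Nat.mul_le_mul_left _ (Nat.pow_le_pow_right hB (by norm_num))
  have p3 : B * B ≤ n * B ^ 3 := by
    calc B * B = 1 * B ^ 2 := by ring
      _ ≤ n * B ^ 3 := Nat.mul_le_mul hn (Nat.pow_le_pow_right hB (by norm_num))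
  have p4 : R ≤ R * (n * B ^ 3) := Nat.le_mul_of_pos_right _ p0
  have q1 : 17 * (Nat.size 17 + varBits R n) ≤ (306 + 17 * R) * (n * B ^ 3) := by
    calc 17 * (Nat.size 17 + varBits R n) ≤ 17 * (5 + (n * B + 4 * B + R + 8)) := by
          unfold varBits
          gcongr
      _ ≤ _ := by nlinarith
  have q2 : n * (Nat.size n + B) ≤ 2 * (n * B ^ 3) := by
    calc n * (Nat.size n + B) ≤ n * (B + B) := by gcongr
      _ ≤ _ := by nlinarith
  have q3 : B * (Nat.size B + B) ≤ 2 * (n * B ^ 3) := by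
    calc B * (Nat.size B + B) ≤ B * (B + B) := by gcongr
      _ ≤ _ := by nlinarith
  have q4 : cells R n * (Nat.size (cells R n) + 2 * B) ≤
      128 * R * (12 + R) * (n * B ^ 3) := by
    calc cells R n * (Nat.size (cells R n) + 2 * B)
        ≤ 128 * R * (n * B ^ 2) * (7 * B + R * B + 3 * B + 2 * B) := by
          rw [← hc]
          gcongr
          nlinarith
      _ = _ := by ring
  have q5 : cells R n * (Nat.size (cells R n) + 1) ≤ 128 * R * (11 + R) * (n * B ^ 3) := by
    calc cells R n * (Nat.size (cells R n) + 1)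
        ≤ 128 * R * (n * B ^ 2) * (7 * B + R * B + 3 * B + B) := by
          rw [← hc]
          gcongr
          nlinarith
      _ = _ := by ring
  rw [e]
  calc _ ≤ (306 + 17 * R) * (n * B ^ 3) + 2 * (n * B ^ 3) + 128 * R * (12 + R) * (n * B ^ 3) +
        128 * R * (11 + R) * (n * B ^ 3) + 2 * (n * B ^ 3) := by gcongr
    _ = _ := by ring

/-- Minimality of `logM n` gives `2 ^ (logM n - 1) < 16 * n ^ 4`, hence `logM n ≤ 5 + 4 * log₂ n`,
and `1 ≤ log₂ n` absorbs the constant into `9 * log₂ n`. -/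
theorem logM_le {n : ℕ} (hn : 2 ≤ n) : (logM n : ℝ) ≤ 9 / Real.log 2 * Real.log n := by
  have hl2 : 0 < Real.log 2 := Real.log_pos one_lt_two
  have hn' : (2 : ℝ) ≤ n := by exact_mod_cast hn
  have hln : Real.log 2 ≤ Real.log n := Real.log_le_log two_pos hn'
  have hB : logM n ≠ 0 := Nat.one_le_iff_ne_zero.1 (one_le_logM (by omega))
  obtain ⟨k, hk⟩ := Nat.exists_eq_succ_of_ne_zero hB
  have h1 : 2 ^ k < 16 * n ^ 4 := Nat.pow_lt_of_lt_clog (show k < logM n by omega)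
  have h2 : (2 : ℝ) ^ k ≤ 2 ^ 4 * n ^ 4 := by
    have : (2 : ℝ) ^ k < 16 * n ^ 4 := by exact_mod_cast h1
    linarith
  have h3 := Real.log_le_log (by positivity) h2
  rw [Real.log_mul (by positivity) (by positivity), Real.log_pow, Real.log_pow,
    Real.log_pow] at h3
  rw [div_mul_eq_mul_div, le_div_iff₀ hl2, hk]
  push_cast at h3 ⊢
  linarith

theorem mainTheorem7 :
    ∃ (α : ℝ) (k : ℕ), ∀ c : ℕ, ∃ (A : StreamAlg) (K : ℝ), ∀ n : ℕ, 2 ≤ n →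
      ∃ S : ℕ, (S : ℝ) ≤ K * ((n : ℝ) * Real.log (n : ℝ) ^ k) ∧
        ∀ (G : LabeledGraph (Fin n)) (σ : List (StreamItem (Fin n))), IsDynamicStream σ G →
          (∀ ω : ℕ → Bool, ∃ C : Setoid (Fin n), A.Outputs S σ ω C) ∧
          coinTosses {ω | ¬ ∃ C : Setoid (Fin n), A.Outputs S σ ω C ∧ IsApproxClustering α G C}
            ≤ ENNReal.ofReal (1 / (n : ℝ) ^ c) := by
  refine ⟨128, 3, fun c => ⟨clusterAlg (c + 3),
    ((310 + 17 * (c + 3) + 128 * (c + 3) * (23 + 2 * (c + 3)) : ℕ) : ℝ) * (9 / Real.log 2) ^ 3,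
    fun n hn => ⟨algSpace (c + 3) n, ?_, fun G σ hσ => ⟨fun ω => ?_, ?_⟩⟩⟩⟩
  · have h1 := (Nat.cast_le (α := ℝ)).2 (algSpace_le (R := c + 3) (show 1 ≤ n by omega))
    generalize 310 + 17 * (c + 3) + 128 * (c + 3) * (23 + 2 * (c + 3)) = D at h1 ⊢
    rw [Nat.cast_mul] at h1
    refine h1.trans ?_
    rw [mul_assoc]
    gcongr
    push_cast
    calc (n : ℝ) * (logM n : ℝ) ^ 3 ≤ n * (9 / Real.log 2 * Real.log n) ^ 3 := by
          gcongr
          exact logM_le hn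
      _ = _ := by ring
  · obtain ⟨x, -, h, -⟩ := exists_outputs (show 0 < n by omega) (c + 3) hσ ω
    exact ⟨_, h⟩
  · exact coinTosses_failure_le hn hσ
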